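/- Let $\mathbb C\{x,y\}$ be the ring of convergent power series with maximal ideal $\mathfrak m$. For $f\in\mathbb C\{x,y\}$, a *facet* of its Newton boundary $\Gamma(f)$ is a compact one-dimensional face $\Delta$ of the convex hull of $\bigcup_{(i,j)}\big((i,j)+\mathbb R_{\ge 0}^2\big)$, the union taken over all $(i,j)$ such that $x^iy^j$ occurs in $f$. Let $w=w(\Delta)=(w(x),w(y))$ be the normal vector of $\Delta$ with coprime positive integer entries, and let $\operatorname{jet}(f,\Delta)$ be the sum of the terms of $f$ lying on $\Delta$. The germ $f$ is *convenient* if a power of $x$ and a power of $y$ occur in $f$. The *saturation* of a polynomial is obtained by dividing it by the highest possible powers of $x$ and $y$. We say that $f$ has *non-degenerate facets* if, for every facet $\Delta$ of $\Gamma(f)$, the saturation $s$ of $\operatorname{jet}(f,\Delta)$ has finite Milnor number at the origin, i.e. $\dim_{\mathbb C}\mathbb C\{x,y\}/\langle \partial s/\partial x,\partial s/\partial y\rangle<\infty$; $f$ has *non-degenerate Newton boundary* if it is convenient and has non-degenerate facets. A $w$-weighted homogeneous non-unit of $\mathbb C[x,y]$ is called *linear homogeneous* if it has degree one in at least one of the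 two variables, and *non-linear homogeneous* otherwise. We say that $f$ is *normalized with respect to the facet* $\Delta$ if there is a factorization in $\mathbb C[x,y]$ $$\operatorname{jet}(f,\Delta)=x^a\,y^b\,g_1\cdots g_n\,\widetilde g$$ with $a,b,n\ge 0$, where $g_1,\dots,g_n$ are irreducible linear homogeneous polynomials not associated to $x$ or $y$ and $\widetilde g$ is a (possibly empty) product of pairwise non-associated irreducible non-linear homogeneous polynomials, such that, with $w=w(\Delta)$: - if $w(x)=w(y)$, then $a\neq 0$ and $b\neq 0$; - if $w(x)>w(y)$ and $a=0$, then $n=0$; - if $w(x)<w(y)$ and $b=0$, then $n=0$. **Lemma.** Let $f\in\mathfrak m^2\subset\mathbb C\{x,y\}$ be a convenient germ with non-degenerate Newton boundary. Then there is a $\mathbb C$-algebra automorphism $\varphi$ of $\mathbb C\{x,y\}$ such that the germ $\varphi(f)$ (which need not be convenient) has non-degenerate facets and is normalized with respect to every facet of its own Newton boundary $\Gamma(\varphi(f))$. -/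

import Mathlib

/-- A formal power series in two variables over `ℂ` is convergent if it converges absolutely on
some polydisc of positive radius around the origin. -/
def IsConvergent (f : MvPowerSeries (Fin 2) ℂ) : Prop :=
  ∃ r : ℝ, 0 < r ∧ Summable fun m : Fin 2 →₀ ℕ => ‖MvPowerSeries.coeff m f‖ * r ^ m.degree

theorem summable_of_radius_le {f : MvPowerSeries (Fin 2) ℂ} {r s : ℝ} (hs : 0 ≤ s) (hsr : s ≤ r)
    (h : Summable fun m : Fin 2 →₀ ℕ => ‖MvPowerSeries.coeff m f‖ * r ^ m.degree) :
    Summable fun m : Fin 2 →₀ ℕ => ‖MvPowerSeries.coeff m f‖ * s ^ m.degree :=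
  h.of_nonneg_of_le (fun _ => by positivity) (fun _ => by gcongr)

theorem isConvergent_add {f g : MvPowerSeries (Fin 2) ℂ} (hf : IsConvergent f)
    (hg : IsConvergent g) : IsConvergent (f + g) := by
  obtain ⟨r, hr, hf⟩ := hf
  obtain ⟨s, hs, hg⟩ := hg
  refine ⟨min r s, lt_min hr hs, ?_⟩
  have hp : 0 ≤ min r s := (lt_min hr hs).le
  refine ((summable_of_radius_le hp (min_le_left _ _) hf).add
    (summable_of_radius_le hp (min_le_right _ _) hg)).of_nonneg_of_le
      (fun _ => by positivity) (fun m => ?_)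
  rw [map_add, ← add_mul]
  gcongr
  exact norm_add_le _ _

theorem isConvergent_mul {f g : MvPowerSeries (Fin 2) ℂ} (hf : IsConvergent f)
    (hg : IsConvergent g) : IsConvergent (f * g) := by
  obtain ⟨r, hr, hf⟩ := hf
  obtain ⟨s, hs, hg⟩ := hg
  have hp : 0 ≤ min r s := (lt_min hr hs).le
  refine ⟨min r s, lt_min hr hs, ?_⟩
  have h1 := summable_of_radius_le hp (min_le_left _ _) hf
  have h2 := summable_of_radius_le hp (min_le_right _ _) hg
  have h3 := summable_sum_mul_antidiagonal_of_summable_mul (A := Fin 2 →₀ ℕ)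
    (f := fun m => ‖MvPowerSeries.coeff m f‖ * min r s ^ m.degree)
    (g := fun m => ‖MvPowerSeries.coeff m g‖ * min r s ^ m.degree)
    (h1.mul_of_nonneg h2 (fun m => mul_nonneg (norm_nonneg _) (pow_nonneg hp _))
      (fun m => mul_nonneg (norm_nonneg _) (pow_nonneg hp _)))
  refine h3.of_nonneg_of_le (fun m => mul_nonneg (norm_nonneg _) (pow_nonneg hp _)) (fun m => ?_)
  rw [MvPowerSeries.coeff_mul]
  refine (mul_le_mul_of_nonneg_right (norm_sum_le _ _) (pow_nonneg hp _)).trans ?_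
  rw [Finset.sum_mul]
  refine Finset.sum_le_sum fun p hpm => le_of_eq ?_
  rw [Finset.HasAntidiagonal.mem_antidiagonal] at hpm
  rw [norm_mul, ← hpm, map_add, pow_add]
  ring

theorem isConvergent_coe (p : MvPolynomial (Fin 2) ℂ) :
    IsConvergent (p : MvPowerSeries (Fin 2) ℂ) := by
  refine ⟨1, one_pos, summable_of_ne_finset_zero (s := p.support) fun m hm => ?_⟩
  rw [MvPolynomial.coeff_coe, MvPolynomial.notMem_support_iff.mp hm, norm_zero, zero_mul]

theorem isConvergent_pderiv (i : Fin 2) {f : MvPowerSeries (Fin 2) ℂ} (hf : IsConvergent f) :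
    IsConvergent (MvPowerSeries.pderiv ℂ i f) := by
  obtain ⟨r, hr, hf⟩ := hf
  refine ⟨r / 2, half_pos hr, ?_⟩
  have hinj : Function.Injective fun m : Fin 2 →₀ ℕ => m + Finsupp.single i 1 :=
    add_left_injective _
  refine ((hf.comp_injective hinj).mul_left (2 / r)).of_nonneg_of_le
    (fun _ => by positivity) (fun m => ?_)
  have h1 : (m i : ℝ) + 1 ≤ 2 ^ (m.degree + 1) := by
    have h2 : m i + 1 ≤ m.degree + 1 := Nat.succ_le_succ (Finsupp.le_degree i m)
    exact_mod_cast h2.trans Nat.lt_two_pow_self.le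
  have h4 : ‖(m i : ℂ) + 1‖ = (m i : ℝ) + 1 := by
    rw [← Nat.cast_succ, Complex.norm_natCast, Nat.cast_succ]
  rw [MvPowerSeries.coeff_pderiv, norm_mul, h4]
  simp only [Function.comp_apply, map_add, Finsupp.degree_single]
  set c := ‖MvPowerSeries.coeff (m + Finsupp.single i 1) f‖
  calc c * ((m i : ℝ) + 1) * (r / 2) ^ m.degree
      ≤ c * 2 ^ (m.degree + 1) * (r / 2) ^ m.degree := by gcongr
    _ = 2 / r * (c * r ^ (m.degree + 1)) := by
        rw [div_pow, pow_succ, pow_succ]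
        field_simp

/-- The ring `ℂ{x, y}` of convergent power series; `x` is the variable `0`, `y` the variable `1`. -/
def ConvergentSeries : Subalgebra ℂ (MvPowerSeries (Fin 2) ℂ) where
  carrier := {f | IsConvergent f}
  mul_mem' := isConvergent_mul
  add_mem' := isConvergent_add
  algebraMap_mem' c := by
    have h := isConvergent_coe (MvPolynomial.C c)
    rwa [MvPolynomial.coe_C] at h

namespace ConvergentSeries

/-- The germ at the origin of a polynomial. -/
def ofPoly (p : MvPolynomial (Fin 2) ℂ) : ConvergentSeries := ⟨p, isConvergent_coe p⟩

/-- The partial derivative of a germ with respect to the `i`-th variable. -/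
noncomputable def partialDeriv (i : Fin 2) (f : ConvergentSeries) : ConvergentSeries :=
  ⟨MvPowerSeries.pderiv ℂ i f, isConvergent_pderiv i f.2⟩

/-- The maximal ideal `𝔪` of `ℂ{x, y}`: the germs vanishing at the origin. -/
noncomputable def maxIdeal : Ideal ConvergentSeries :=
  RingHom.ker ((MvPowerSeries.constantCoeff (σ := Fin 2) (R := ℂ)).comp
    ConvergentSeries.val.toRingHom)

/-- The Jacobian ideal of a germ. -/
noncomputable def jacobianIdeal (f : ConvergentSeries) : Ideal ConvergentSeries :=
  Ideal.span (Set.range fun i => partialDeriv i f)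

/-- The Milnor number `dim_ℂ ℂ{x, y} / Jac(f)` is finite. -/
def HasFiniteMilnorNumber (f : ConvergentSeries) : Prop :=
  Module.Finite ℂ (ConvergentSeries ⧸ jacobianIdeal f)

/-- The point of the plane with the coordinates of an exponent vector. -/
def exponentPoint (m : Fin 2 →₀ ℕ) : Fin 2 → ℝ := fun i => (m i : ℝ)

/-- The convex hull of the union of the quadrants `m + ℝ²_{≥0}`, `m` in the support of `f`. -/
def newtonPolyhedron (f : ConvergentSeries) : Set (Fin 2 → ℝ) :=
  convexHull ℝ {p | ∃ m : Fin 2 →₀ ℕ,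
    MvPowerSeries.coeff m (f : MvPowerSeries (Fin 2) ℂ) ≠ 0 ∧ exponentPoint m ≤ p}

/-- A facet of the Newton boundary: a compact one-dimensional face of the Newton polyhedron.
(A compact face with more than one point is neither a vertex nor the whole polyhedron.) -/
def IsFacet (f : ConvergentSeries) (Δ : Set (Fin 2 → ℝ)) : Prop :=
  IsExposed ℝ (newtonPolyhedron f) Δ ∧ IsCompact Δ ∧ Δ.Nontrivial

/-- `w` is the weight of the segment `Δ`: it has positive integer entries without common factor
and is normal to `Δ`. -/
def IsWeightOf (w : Fin 2 → ℕ) (Δ : Set (Fin 2 → ℝ)) : Prop :=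
  0 < w 0 ∧ 0 < w 1 ∧ (w 0).Coprime (w 1) ∧
    ∀ p ∈ Δ, ∀ q ∈ Δ, (w 0 : ℝ) * p 0 + w 1 * p 1 = w 0 * q 0 + w 1 * q 1

open Classical in
/-- `jet(f, Δ)`: the sum of the terms of `f` lying on `Δ`, a finite sum for bounded `Δ`. -/
noncomputable def facetJet (f : ConvergentSeries) (Δ : Set (Fin 2 → ℝ)) :
    MvPolynomial (Fin 2) ℂ :=
  ∑ᶠ m : Fin 2 →₀ ℕ, if exponentPoint m ∈ Δ then
    MvPolynomial.monomial m (MvPowerSeries.coeff m (f : MvPowerSeries (Fin 2) ℂ)) else 0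

/-- `h` is the saturation of `g`: `g = x ^ k * y ^ l * h` with `k`, `l` maximal. -/
def IsSaturation (g h : MvPolynomial (Fin 2) ℂ) : Prop :=
  (∃ k l : ℕ, g = MvPolynomial.X 0 ^ k * MvPolynomial.X 1 ^ l * h) ∧
    ¬ MvPolynomial.X 0 ∣ h ∧ ¬ MvPolynomial.X 1 ∣ h

/-- The Newton boundary meets both coordinate axes, that is, a power of each of the two variables
occurs in `f`. -/
def IsConvenient (f : ConvergentSeries) : Prop :=
  ∀ i : Fin 2, ∃ k : ℕ,
    MvPowerSeries.coeff (Finsupp.single i k) (f : MvPowerSeries (Fin 2) ℂ) ≠ 0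

/-- For every facet, the saturation of the jet of `f` has finite Milnor number. -/
def HasNondegenerateFacets (f : ConvergentSeries) : Prop :=
  ∀ Δ, IsFacet f Δ → ∃ h, IsSaturation (facetJet f Δ) h ∧ HasFiniteMilnorNumber (ofPoly h)

/-- `f` is convenient with non-degenerate Newton boundary. -/
def HasNondegenerateNewtonBoundary (f : ConvergentSeries) : Prop :=
  IsConvenient f ∧ HasNondegenerateFacets f

/-- A non-unit that is weighted homogeneous with respect to `w`. -/
def IsHomogeneousNonunit (w : Fin 2 → ℕ) (p : MvPolynomial (Fin 2) ℂ) : Prop :=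
  ¬ IsUnit p ∧ ∃ d : ℕ, MvPolynomial.IsWeightedHomogeneous w p d

/-- The polynomial has degree one in at least one of the two variables. -/
def IsLinearInOneVariable (p : MvPolynomial (Fin 2) ℂ) : Prop :=
  p.degreeOf 0 = 1 ∨ p.degreeOf 1 = 1

/-- `g = x ^ a * y ^ b * g₁ ⋯ gₙ * (h₁ ⋯ hₖ)` is the factorization of a `w`-weighted homogeneous
polynomial, where the `gᵢ` are the linear homogeneous irreducible factors not associated to `x` or
`y` and the `hᵢ` are pairwise non-associated non-linear homogeneous irreducible factors. -/
def IsFactorization (w : Fin 2 → ℕ) (g : MvPolynomial (Fin 2) ℂ) (a b : ℕ)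
    (gs hs : List (MvPolynomial (Fin 2) ℂ)) : Prop :=
  g = MvPolynomial.X 0 ^ a * MvPolynomial.X 1 ^ b * gs.prod * hs.prod ∧
    (∀ p ∈ gs, Irreducible p ∧ IsHomogeneousNonunit w p ∧ IsLinearInOneVariable p ∧
      ¬ Associated p (MvPolynomial.X 0) ∧ ¬ Associated p (MvPolynomial.X 1)) ∧
    (∀ p ∈ hs, Irreducible p ∧ IsHomogeneousNonunit w p ∧ ¬ IsLinearInOneVariable p) ∧
    hs.Pairwise fun p q => ¬ Associated p q

/-- `f` is normalized with respect to the facet `Δ`. The numbers `a`, `b` and `n = gs.length` in the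
factorization are unique. -/
def IsNormalizedAt (f : ConvergentSeries) (Δ : Set (Fin 2 → ℝ)) : Prop :=
  ∃ w : Fin 2 → ℕ, IsWeightOf w Δ ∧ ∃ (a b : ℕ) (gs hs : List (MvPolynomial (Fin 2) ℂ)),
    IsFactorization w (facetJet f Δ) a b gs hs ∧
      (w 0 = w 1 → a ≠ 0 ∧ b ≠ 0) ∧
      (w 1 < w 0 → a = 0 → gs.length = 0) ∧
      (w 0 < w 1 → b = 0 → gs.length = 0)

/-- The germs `f` and `g` are transformed into each other by a `ℂ`-algebra automorphism of
`ℂ{x, y}`. -/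
def RightEquivalent (f g : ConvergentSeries) : Prop :=
  ∃ φ : ConvergentSeries ≃ₐ[ℂ] ConvergentSeries, φ f = g

end ConvergentSeries

/-!
Take a facet of weight `(α, 1)` whose jet has a term free of `x`. The saturation of the jet has
finite Milnor number, so by Euler's identity its roots `x = c y ^ α` are simple, and the implicit
function theorem lifts such a root to a convergent branch `x = φ(y) = c y ^ α + ⋯` of `f`. The shear
`x ↦ x + φ(y)` makes `f` divisible by `x`. It keeps the flatter facets together with their jets and
removes the steeper ones; the new jet of the facet itself, where it survives, is the old one sheared
by `c y ^ α`, so its saturation has finite Milnor number by Euler's identity and the chain rule.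
Straightening a branch over each axis in this way removes all facets of this kind, and divisibility
by the other variable is preserved. A germ without such facets is normalized, since by
non-degeneracy the irreducible factors of the saturated jets are pairwise non-associated.
-/

section PowerSeries

open MvPowerSeries
open scoped ENNReal NNReal

/-! ### The filtration by weight -/

section WeightIdeal

variable {σ τ R : Type*} [CommRing R]

/-- The ideal of the power series all of whose terms have weight at least `d`. -/
def weightIdeal (w : σ → ℕ) (d : ℕ) : Ideal (MvPowerSeries σ R) where
  carrier := {f | (d : ℕ∞) ≤ f.weightedOrder w}
  zero_mem' := by simp
  add_mem' hf hg := (le_min hf hg).trans (min_weightedOrder_le_add w)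
  smul_mem' _ _ hf := (le_add_of_nonneg_of_le zero_le hf).trans (le_weightedOrder_mul w)

theorem mem_weightIdeal {w : σ → ℕ} {d : ℕ} {f : MvPowerSeries σ R} :
    f ∈ weightIdeal w d ↔ ∀ m, coeff m f ≠ 0 → d ≤ Finsupp.weight w m :=
  ⟨fun hf _ hm => Nat.cast_le.mp (le_trans (b := f.weightedOrder w) hf (weightedOrder_le w hm)),
    fun h => nat_le_weightedOrder w fun m hm => by_contra fun hne => hm.not_ge (h m hne)⟩

theorem coeff_eq_zero_of_mem_weightIdeal {w : σ → ℕ} {d : ℕ} {f : MvPowerSeries σ R}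
    (hf : f ∈ weightIdeal w d) {m : σ →₀ ℕ} (hm : Finsupp.weight w m < d) : coeff m f = 0 :=
  by_contra fun h => hm.not_ge (mem_weightIdeal.mp hf m h)

theorem weightIdeal_anti (w : σ → ℕ) : Antitone (weightIdeal (R := R) w) :=
  fun _ _ h _ hf => mem_weightIdeal.mpr fun m hm => h.trans (mem_weightIdeal.mp hf m hm)

theorem weightIdeal_zero (w : σ → ℕ) : weightIdeal (R := R) w 0 = ⊤ :=
  top_unique fun _ _ => mem_weightIdeal.mpr fun _ _ => Nat.zero_le _

theorem mul_mem_weightIdeal {w : σ → ℕ} {d e : ℕ} {f g : MvPowerSeries σ R}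
    (hf : f ∈ weightIdeal w d) (hg : g ∈ weightIdeal w e) : f * g ∈ weightIdeal w (d + e) :=
  (Nat.cast_add d e).trans_le ((add_le_add hf hg).trans (le_weightedOrder_mul w))

theorem pow_mem_weightIdeal {w : σ → ℕ} {d : ℕ} {f : MvPowerSeries σ R}
    (hf : f ∈ weightIdeal w d) (n : ℕ) : f ^ n ∈ weightIdeal w (n * d) := by
  induction n with
  | zero => simp [weightIdeal_zero]
  | succ n ih => rw [pow_succ, Nat.succ_mul]; exact mul_mem_weightIdeal ih hf

theorem prod_mem_weightIdeal {ι : Type*} {w : σ → ℕ} {v : ι → ℕ} {a : ι → MvPowerSeries σ R}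
    {s : Finset ι} (ha : ∀ k ∈ s, a k ∈ weightIdeal w (v k)) :
    ∏ k ∈ s, a k ∈ weightIdeal w (∑ k ∈ s, v k) := by
  refine le_trans ?_ (le_weightedOrder_prod w a s)
  rw [Nat.cast_sum]
  exact Finset.sum_le_sum ha

theorem monomial_mem_weightIdeal {w : σ → ℕ} {d : ℕ} {m : σ →₀ ℕ}
    (h : d ≤ Finsupp.weight w m) (c : R) : monomial m c ∈ weightIdeal w d := by
  classical
  refine mem_weightIdeal.mpr fun n hn => ?_
  rw [coeff_monomial] at hn
  obtain rfl : n = m := by_contra fun h => hn (if_neg h)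
  exact h

theorem X_mem_weightIdeal (w : σ → ℕ) (k : σ) :
    (X k : MvPowerSeries σ R) ∈ weightIdeal w (w k) :=
  monomial_mem_weightIdeal (by simp [Finsupp.weight_single]) 1

theorem mul_sub_mul_mem_weightIdeal {w : σ → ℕ} {d e : ℕ} {f f' g g' : MvPowerSeries σ R}
    (hf : f - f' ∈ weightIdeal w (d + 1)) (hg : g - g' ∈ weightIdeal w (e + 1))
    (hf' : f' ∈ weightIdeal w d) (hg0 : g ∈ weightIdeal w e) :
    f * g - f' * g' ∈ weightIdeal w (d + e + 1) := by
  have h : f * g - f' * g' = (f - f') * g + f' * (g - g') := by ring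
  rw [h]
  refine add_mem ?_ ?_
  · simpa only [add_right_comm] using mul_mem_weightIdeal hf hg0
  · simpa only [add_assoc] using mul_mem_weightIdeal hf' hg

theorem pow_sub_pow_mem_weightIdeal {w : σ → ℕ} {d : ℕ} {f f' : MvPowerSeries σ R}
    (h : f - f' ∈ weightIdeal w (d + 1)) (hf : f ∈ weightIdeal w d)
    (hf' : f' ∈ weightIdeal w d) (n : ℕ) :
    f ^ n - f' ^ n ∈ weightIdeal w (n * d + 1) := by
  induction n with
  | zero => simp
  | succ n ih =>
    rw [pow_succ, pow_succ, Nat.succ_mul]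
    exact mul_sub_mul_mem_weightIdeal ih h (pow_mem_weightIdeal hf' _) hf

theorem prod_sub_prod_mem_weightIdeal {ι : Type*} {w : σ → ℕ} {v : ι → ℕ}
    {a b : ι → MvPowerSeries σ R} {s : Finset ι} (ha : ∀ k ∈ s, a k ∈ weightIdeal w (v k))
    (hb : ∀ k ∈ s, b k ∈ weightIdeal w (v k))
    (hab : ∀ k ∈ s, a k - b k ∈ weightIdeal w (v k + 1)) :
    ∏ k ∈ s, a k - ∏ k ∈ s, b k ∈ weightIdeal w (∑ k ∈ s, v k + 1) := by
  induction s using Finset.cons_induction with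
  | empty => simp
  | cons i s hi ih =>
    simp only [Finset.forall_mem_cons] at ha hb hab
    simp only [Finset.prod_cons, Finset.sum_cons]
    exact mul_sub_mul_mem_weightIdeal hab.1 (ih ha.2 hb.2 hab.2) hb.1 (prod_mem_weightIdeal ha.2)

theorem finsuppProd_mem_weightIdeal {w : τ → ℕ} {v : σ → ℕ} {a : σ → MvPowerSeries τ R}
    (ha : ∀ k, a k ∈ weightIdeal w (v k)) (m : σ →₀ ℕ) :
    (m.prod fun k n => a k ^ n) ∈ weightIdeal w (Finsupp.weight v m) :=
  prod_mem_weightIdeal fun k _ => pow_mem_weightIdeal (ha k) (m k)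

theorem finsuppProd_sub_finsuppProd_mem_weightIdeal {w : τ → ℕ} {v : σ → ℕ}
    {a b : σ → MvPowerSeries τ R} (ha : ∀ k, a k ∈ weightIdeal w (v k))
    (hb : ∀ k, b k ∈ weightIdeal w (v k)) (hab : ∀ k, a k - b k ∈ weightIdeal w (v k + 1))
    (m : σ →₀ ℕ) :
    (m.prod fun k n => a k ^ n) - (m.prod fun k n => b k ^ n) ∈
      weightIdeal w (Finsupp.weight v m + 1) :=
  prod_sub_prod_mem_weightIdeal (fun k _ => pow_mem_weightIdeal (ha k) _)
    (fun k _ => pow_mem_weightIdeal (hb k) _)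
    fun k _ => pow_sub_pow_mem_weightIdeal (hab k) (ha k) (hb k) _

theorem subst_sub_subst_mem_weightIdeal {w : τ → ℕ} {e : ℕ} {a b : σ → MvPowerSeries τ R}
    (ha : HasSubst a) (hb : HasSubst b) {f g : MvPowerSeries σ R}
    (h : ∀ m, coeff m f • (m.prod fun k n => a k ^ n) -
      coeff m g • (m.prod fun k n => b k ^ n) ∈ weightIdeal w e) :
    subst a f - subst b g ∈ weightIdeal w e := by
  refine mem_weightIdeal.mpr fun n hn => not_lt.mp fun hlt => hn ?_
  rw [map_sub, coeff_subst ha, coeff_subst hb,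
    ← finsum_sub_distrib (coeff_subst_finite ha f n) (coeff_subst_finite hb g n)]
  exact finsum_eq_zero_of_forall_eq_zero fun m => coeff_eq_zero_of_mem_weightIdeal (h m) hlt

theorem subst_mem_weightIdeal {w : τ → ℕ} {v : σ → ℕ} {d : ℕ} {a : σ → MvPowerSeries τ R}
    (ha : HasSubst a) (hav : ∀ k, a k ∈ weightIdeal w (v k)) {f : MvPowerSeries σ R}
    (hf : f ∈ weightIdeal v d) : subst a f ∈ weightIdeal w d := by
  refine mem_weightIdeal.mpr fun n hn => not_lt.mp fun hlt => hn ?_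
  rw [coeff_subst ha]
  refine finsum_eq_zero_of_forall_eq_zero fun m => ?_
  by_cases hm : coeff m f = 0
  · rw [hm, zero_smul]
  · rw [coeff_eq_zero_of_mem_weightIdeal (finsuppProd_mem_weightIdeal hav m)
      (hlt.trans_le (mem_weightIdeal.mp hf m hm)), smul_zero]

end WeightIdeal

section WeightedJet

variable {σ τ R : Type*} [CommRing R]

theorem coeff_finsum_ite_monomial {P : (σ →₀ ℕ) → Prop} [DecidablePred P] (hP : {m | P m}.Finite)
    (c : (σ →₀ ℕ) → R) (n : σ →₀ ℕ) :
    MvPolynomial.coeff n (∑ᶠ m, if P m then MvPolynomial.monomial m (c m) else 0) =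
      if P n then c n else 0 := by
  classical
  rw [← MvPolynomial.lcoeff_apply (R := R), map_finsum _ (hP.subset fun m hm => by
      by_contra hPm; exact hm (if_neg hPm)), finsum_eq_single _ n fun m hmn => ?_]
  · split_ifs <;> simp
  · split_ifs <;> simp [hmn]

open Classical in
/-- The sum of the terms of weight `d` of a power series in finitely many variables, for a positive
weight; it is a polynomial, since only finitely many monomials have weight `d`. -/
noncomputable def weightedJet (w : σ → ℕ) (d : ℕ) (f : MvPowerSeries σ R) : MvPolynomial σ R :=
  ∑ᶠ m, if Finsupp.weight w m = d then MvPolynomial.monomial m (coeff m f) else 0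

variable [Finite σ] {w : σ → ℕ}

theorem finite_setOf_weight_eq (hw : ∀ k, 0 < w k) (d : ℕ) :
    {m : σ →₀ ℕ | Finsupp.weight w m = d}.Finite :=
  (Finsupp.finite_of_nat_weight_le w (fun k => (hw k).ne') d).subset fun _ hm => hm.le

theorem coeff_weightedJet (hw : ∀ k, 0 < w k) (d : ℕ) (f : MvPowerSeries σ R) (n : σ →₀ ℕ) :
    MvPolynomial.coeff n (weightedJet w d f) = if Finsupp.weight w n = d then coeff n f else 0 :=
  coeff_finsum_ite_monomial (finite_setOf_weight_eq hw d) _ n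

theorem isWeightedHomogeneous_weightedJet (hw : ∀ k, 0 < w k) (d : ℕ) (f : MvPowerSeries σ R) :
    MvPolynomial.IsWeightedHomogeneous w (weightedJet w d f) d := by
  intro m hm
  rw [coeff_weightedJet hw] at hm
  exact by_contra fun h => hm (if_neg h)

theorem subst_sub_subst_weightedJet_mem (hw : ∀ k, 0 < w k) {v : τ → ℕ} {d : ℕ}
    {a b : σ → MvPowerSeries τ R} (ha : HasSubst a) (hb : HasSubst b)
    (hav : ∀ k, a k ∈ weightIdeal v (w k)) (hbv : ∀ k, b k ∈ weightIdeal v (w k))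
    (hab : ∀ k, a k - b k ∈ weightIdeal v (w k + 1)) {f : MvPowerSeries σ R}
    (hf : f ∈ weightIdeal w d) :
    subst a f - subst b (weightedJet w d f : MvPowerSeries σ R) ∈ weightIdeal v (d + 1) := by
  refine subst_sub_subst_mem_weightIdeal ha hb fun m => ?_
  rw [MvPolynomial.coeff_coe, coeff_weightedJet hw]
  rcases lt_trichotomy (Finsupp.weight w m) d with h | h | h
  · simp [h.ne, coeff_eq_zero_of_mem_weightIdeal hf h]
  · rw [if_pos h, ← smul_sub, ← h, smul_eq_C_mul]
    exact Ideal.mul_mem_left _ _ (finsuppProd_sub_finsuppProd_mem_weightIdeal hav hbv hab m)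
  · rw [if_neg h.ne', zero_smul, sub_zero, smul_eq_C_mul]
    exact Ideal.mul_mem_left _ _ (weightIdeal_anti v h (finsuppProd_mem_weightIdeal hav m))

theorem weightedJet_eq_of_sub_mem (hw : ∀ k, 0 < w k) {d : ℕ} {f g : MvPowerSeries σ R}
    (h : f - g ∈ weightIdeal w (d + 1)) : weightedJet w d f = weightedJet w d g := by
  ext n
  rw [coeff_weightedJet hw, coeff_weightedJet hw]
  split_ifs with hn
  · have := coeff_eq_zero_of_mem_weightIdeal h (m := n) (by omega)
    rwa [map_sub, sub_eq_zero] at this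
  · rfl

theorem weightedJet_coe (hw : ∀ k, 0 < w k) {d : ℕ} {p : MvPolynomial σ R}
    (hp : MvPolynomial.IsWeightedHomogeneous w p d) :
    weightedJet w d (p : MvPowerSeries σ R) = p := by
  ext n
  rw [coeff_weightedJet hw, MvPolynomial.coeff_coe]
  split_ifs with hn
  · rfl
  · exact (hp.coeff_eq_zero n hn).symm

end WeightedJet

/-! ### Substitution into convergent power series -/

section PolydiscNorm

variable {σ τ R : Type*} [NormedCommRing R]

/-- The sum of the absolute values of the terms of a power series on the polycircle of polyradius
`ρ`, possibly infinite. -/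
noncomputable def polydiscNorm (ρ : σ → ℝ≥0∞) (f : MvPowerSeries σ R) : ℝ≥0∞ :=
  ∑' m : σ →₀ ℕ, ‖coeff m f‖ₑ * m.prod fun k n => ρ k ^ n

theorem finsuppProd_pow_add {M : Type*} [CommMonoid M] (ρ : σ → M) (m n : σ →₀ ℕ) :
    ((m + n).prod fun k n => ρ k ^ n) = (m.prod fun k n => ρ k ^ n) * n.prod fun k n => ρ k ^ n :=
  Finsupp.prod_add_index' (fun _ => pow_zero _) fun _ => pow_add _

theorem finsuppProd_const_pow {M : Type*} [CommMonoid M] (r : M) (m : σ →₀ ℕ) :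
    (m.prod fun _ n => r ^ n) = r ^ m.degree :=
  Finset.prod_pow_eq_pow_sum _ _ _

theorem polydiscNorm_mono {ρ ρ' : σ → ℝ≥0∞} (h : ρ ≤ ρ') (f : MvPowerSeries σ R) :
    polydiscNorm ρ f ≤ polydiscNorm ρ' f :=
  ENNReal.tsum_le_tsum fun m => by
    gcongr
    exact Finset.prod_le_prod' fun k _ => pow_le_pow_left' (h k) _

theorem enorm_mul_le (x y : R) : ‖x * y‖ₑ ≤ ‖x‖ₑ * ‖y‖ₑ := enorm_smul_le

theorem polydiscNorm_mul_le (ρ : σ → ℝ≥0∞) (f g : MvPowerSeries σ R) :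
    polydiscNorm ρ (f * g) ≤ polydiscNorm ρ f * polydiscNorm ρ g := by
  classical
  have h : polydiscNorm ρ f * polydiscNorm ρ g = ∑' p : (σ →₀ ℕ) × (σ →₀ ℕ),
      (‖coeff p.1 f‖ₑ * p.1.prod fun k n => ρ k ^ n) *
        (‖coeff p.2 g‖ₑ * p.2.prod fun k n => ρ k ^ n) := by
    rw [ENNReal.tsum_prod', polydiscNorm, ← ENNReal.tsum_mul_right]
    exact tsum_congr fun m => ENNReal.tsum_mul_left.symm
  rw [h, ← (Finset.HasAntidiagonal.sigmaAntidiagonalEquivProd (A := σ →₀ ℕ)).tsum_eq,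
    ENNReal.tsum_sigma']
  refine ENNReal.tsum_le_tsum fun m => ?_
  refine le_trans ?_ (Finset.tsum_subtype (Finset.HasAntidiagonal.antidiagonal m) fun p =>
    (‖coeff p.1 f‖ₑ * p.1.prod fun k n => ρ k ^ n) *
      (‖coeff p.2 g‖ₑ * p.2.prod fun k n => ρ k ^ n)).ge
  rw [coeff_mul]
  refine (mul_le_mul_left (enorm_sum_le _ _) _).trans ?_
  rw [Finset.sum_mul]
  refine Finset.sum_le_sum fun p hp => (mul_le_mul_left ((enorm_mul_le _ _)) _).trans_eq ?_
  rw [← Finset.HasAntidiagonal.mem_antidiagonal.mp hp, finsuppProd_pow_add]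
  ring

theorem polydiscNorm_monomial (ρ : σ → ℝ≥0∞) (m : σ →₀ ℕ) (c : R) :
    polydiscNorm ρ (monomial m c) = ‖c‖ₑ * m.prod fun k n => ρ k ^ n := by
  classical
  rw [polydiscNorm, tsum_eq_single m, coeff_monomial_same]
  intro n hn
  rw [coeff_monomial_ne hn, enorm_zero, zero_mul]

theorem polydiscNorm_smul_radius_le {t : ℝ≥0∞} (ht : t ≤ 1) (r : ℝ≥0∞) {f : MvPowerSeries σ R}
    (hf : constantCoeff f = 0) :
    polydiscNorm (fun _ => t * r) f ≤ t * polydiscNorm (fun _ => r) f := by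
  rw [polydiscNorm, polydiscNorm, ← ENNReal.tsum_mul_left]
  refine ENNReal.tsum_le_tsum fun m => ?_
  rcases eq_or_ne m 0 with rfl | hm
  · simp [hf]
  · have hdeg : m.degree ≠ 0 := by rwa [Ne, Finsupp.degree_eq_zero_iff]
    rw [finsuppProd_const_pow, finsuppProd_const_pow, mul_pow, mul_left_comm]
    gcongr
    exact pow_le_of_le_one zero_le ht hdeg

variable [NormOneClass R]

theorem polydiscNorm_one (ρ : σ → ℝ≥0∞) : polydiscNorm ρ (1 : MvPowerSeries σ R) = 1 := by
  simpa using polydiscNorm_monomial ρ 0 (1 : R)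

theorem polydiscNorm_X (ρ : σ → ℝ≥0∞) (k : σ) :
    polydiscNorm ρ (X k : MvPowerSeries σ R) = ρ k := by
  simp [X, polydiscNorm_monomial]

theorem polydiscNorm_pow_le (ρ : σ → ℝ≥0∞) (f : MvPowerSeries σ R) (n : ℕ) :
    polydiscNorm ρ (f ^ n) ≤ polydiscNorm ρ f ^ n := by
  induction n with
  | zero => rw [pow_zero, pow_zero, polydiscNorm_one]
  | succ n ih =>
    rw [pow_succ, pow_succ]
    exact (polydiscNorm_mul_le _ _ _).trans (by gcongr)

theorem polydiscNorm_finsuppProd_le (ρ : τ → ℝ≥0∞) (a : σ → MvPowerSeries τ R) (m : σ →₀ ℕ) :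
    polydiscNorm ρ (m.prod fun k n => a k ^ n) ≤ m.prod fun k n => polydiscNorm ρ (a k) ^ n := by
  refine (Finset.le_prod_of_submultiplicative _ (polydiscNorm_one ρ).le
    (polydiscNorm_mul_le ρ) _ _).trans ?_
  exact Finset.prod_le_prod' fun k _ => polydiscNorm_pow_le ρ (a k) (m k)

theorem polydiscNorm_subst_le (ρ : τ → ℝ≥0∞) {a : σ → MvPowerSeries τ R} (ha : HasSubst a)
    (f : MvPowerSeries σ R) :
    polydiscNorm ρ (subst a f) ≤ polydiscNorm (fun k => polydiscNorm ρ (a k)) f := by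
  have hcoeff : ∀ e, ‖coeff e (subst a f)‖ₑ ≤
      ∑' m, ‖coeff m f‖ₑ * ‖coeff e (m.prod fun k n => a k ^ n)‖ₑ := by
    intro e
    rw [coeff_subst ha, finsum_eq_sum _ (coeff_subst_finite ha f e)]
    refine (enorm_sum_le _ _).trans ((Finset.sum_le_sum fun m _ => ?_).trans
      (ENNReal.sum_le_tsum _))
    exact enorm_mul_le _ _
  calc polydiscNorm ρ (subst a f)
      ≤ ∑' e : τ →₀ ℕ, ∑' m, ‖coeff m f‖ₑ *
          (‖coeff e (m.prod fun k n => a k ^ n)‖ₑ * e.prod fun k n => ρ k ^ n) := by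
        refine ENNReal.tsum_le_tsum fun e => (mul_le_mul_left (hcoeff e) _).trans_eq ?_
        simp_rw [← ENNReal.tsum_mul_right, mul_assoc]
    _ = ∑' m, ‖coeff m f‖ₑ * polydiscNorm ρ (m.prod fun k n => a k ^ n) := by
        rw [ENNReal.tsum_comm]
        exact tsum_congr fun m => ENNReal.tsum_mul_left
    _ ≤ polydiscNorm (fun k => polydiscNorm ρ (a k)) f :=
        ENNReal.tsum_le_tsum fun m => mul_le_mul_right (polydiscNorm_finsuppProd_le ρ a m) _

end PolydiscNorm

theorem exists_pos_le_one_mul_le {M : ℝ≥0∞} (hM : M ≠ ∞) {ε : ℝ≥0} (hε : 0 < ε) :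
    ∃ t : ℝ≥0, 0 < t ∧ t ≤ 1 ∧ t * M ≤ ε := by
  obtain ⟨t, ht, htM⟩ := ENNReal.exists_nnreal_pos_mul_lt hM (ENNReal.coe_ne_zero.mpr hε.ne')
  refine ⟨min t 1, lt_min ht one_pos, min_le_right _ _, htM.le.trans' ?_⟩
  gcongr
  exact min_le_left _ _

namespace ConvergentSeries

theorem isConvergent_iff_polydiscNorm_ne_top {f : MvPowerSeries (Fin 2) ℂ} :
    IsConvergent f ↔ ∃ r : ℝ≥0, 0 < r ∧ polydiscNorm (fun _ => r) f ≠ ∞ := by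
  have key : ∀ r : ℝ≥0, polydiscNorm (fun _ => r) f ≠ ∞ ↔
      Summable fun m : Fin 2 →₀ ℕ => ‖coeff m f‖ * (r : ℝ) ^ m.degree := by
    intro r
    have hcoe : polydiscNorm (fun _ => r) f =
        ∑' m : Fin 2 →₀ ℕ, ((‖coeff m f‖₊ * r ^ m.degree : ℝ≥0) : ℝ≥0∞) := by
      refine tsum_congr fun m => ?_
      rw [finsuppProd_const_pow, ENNReal.coe_mul, ENNReal.coe_pow, enorm_eq_nnnorm]
    rw [hcoe, ENNReal.tsum_coe_ne_top_iff_summable, ← NNReal.summable_coe]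
    simp
  constructor
  · rintro ⟨r, hr, h⟩
    exact ⟨⟨r, hr.le⟩, hr, (key _).mpr h⟩
  · rintro ⟨r, hr, h⟩
    exact ⟨r, hr, (key r).mp h⟩

theorem exists_polydiscNorm_le {f : MvPowerSeries (Fin 2) ℂ} (hc : IsConvergent f)
    (hf : constantCoeff f = 0) {ε : ℝ≥0} (hε : 0 < ε) :
    ∃ s : ℝ≥0, 0 < s ∧ polydiscNorm (fun _ => s) f ≤ ε := by
  obtain ⟨r, hr, hN⟩ := isConvergent_iff_polydiscNorm_ne_top.mp hc
  obtain ⟨t, ht, ht1, htε⟩ := exists_pos_le_one_mul_le hN hε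
  refine ⟨t * r, mul_pos ht hr, ?_⟩
  push_cast
  exact (polydiscNorm_smul_radius_le (mod_cast ht1) r hf).trans htε

theorem isConvergent_subst {a : Fin 2 → MvPowerSeries (Fin 2) ℂ}
    (ha : ∀ k, IsConvergent (a k)) (ha0 : ∀ k, constantCoeff (a k) = 0)
    {f : MvPowerSeries (Fin 2) ℂ} (hf : IsConvergent f) : IsConvergent (subst a f) := by
  obtain ⟨r, hr, hN⟩ := isConvergent_iff_polydiscNorm_ne_top.mp hf
  choose s hs hsr using fun k => exists_polydiscNorm_le (ha k) (ha0 k) hr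
  have hmin : ∀ k, min (s 0) (s 1) ≤ s k :=
    Fin.forall_fin_two.mpr ⟨min_le_left _ _, min_le_right _ _⟩
  refine isConvergent_iff_polydiscNorm_ne_top.mpr ⟨min (s 0) (s 1), lt_min (hs 0) (hs 1), ?_⟩
  refine ne_top_of_le_ne_top hN ((polydiscNorm_subst_le _
    (hasSubst_of_constantCoeff_zero ha0) f).trans (polydiscNorm_mono (fun k => ?_) f))
  exact (polydiscNorm_mono (fun _ => ENNReal.coe_le_coe.mpr (hmin k)) (a k)).trans (hsr k)

/-- Substitution of germs vanishing at the origin as an endomorphism of `ℂ{x, y}`. -/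
noncomputable def substHom (a : Fin 2 → ConvergentSeries)
    (ha : ∀ k, constantCoeff (a k : MvPowerSeries (Fin 2) ℂ) = 0) :
    ConvergentSeries →ₐ[ℂ] ConvergentSeries :=
  ((substAlgHom (R := ℂ) (hasSubst_of_constantCoeff_zero ha)).comp ConvergentSeries.val).codRestrict
    ConvergentSeries fun f => by
      rw [AlgHom.comp_apply, substAlgHom_apply]
      exact isConvergent_subst (fun k => (a k).2) ha f.2

theorem coe_substHom (a : Fin 2 → ConvergentSeries)
    (ha : ∀ k, constantCoeff (a k : MvPowerSeries (Fin 2) ℂ) = 0) (f : ConvergentSeries) :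
    (substHom a ha f : MvPowerSeries (Fin 2) ℂ) =
      subst (fun k => (a k : MvPowerSeries (Fin 2) ℂ)) (f : MvPowerSeries (Fin 2) ℂ) :=
  substAlgHom_apply (hasSubst_of_constantCoeff_zero ha) _

end ConvergentSeries

/-! ### The implicit function theorem -/

section VarFree

variable {σ τ R : Type*} [CommRing R]

/-- The subalgebra of the power series in which the variable `i` does not occur. -/
def varFree (R : Type*) [CommRing R] (i : σ) : Subalgebra R (MvPowerSeries σ R) where
  carrier := {f | ∀ m, coeff m f ≠ 0 → m i = 0}
  mul_mem' {f g} hf hg m hm := by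
    classical
    rw [coeff_mul] at hm
    obtain ⟨p, hp, hne⟩ := Finset.exists_ne_zero_of_sum_ne_zero hm
    rw [← Finset.HasAntidiagonal.mem_antidiagonal.mp hp, Finsupp.add_apply,
      hf _ (left_ne_zero_of_mul hne), hg _ (right_ne_zero_of_mul hne)]
  add_mem' {f g} hf hg m hm := by
    by_cases h : coeff m f = 0
    · exact hg m (by rwa [map_add, h, zero_add] at hm)
    · exact hf m h
  algebraMap_mem' c m hm := by
    classical
    rw [MvPowerSeries.algebraMap_apply, Algebra.algebraMap_self_apply, coeff_C] at hm
    obtain rfl : m = 0 := by_contra fun h => hm (if_neg h)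
    rfl

theorem mem_varFree {i : σ} {f : MvPowerSeries σ R} :
    f ∈ varFree R i ↔ ∀ m, coeff m f ≠ 0 → m i = 0 :=
  Iff.rfl

theorem X_mem_varFree {i k : σ} (hk : k ≠ i) : (X k : MvPowerSeries σ R) ∈ varFree R i := by
  classical
  refine mem_varFree.mpr fun m hm => ?_
  rw [coeff_X] at hm
  obtain rfl : m = Finsupp.single k 1 := by_contra fun h => hm (if_neg h)
  exact Finsupp.single_eq_of_ne hk.symm

theorem finsuppProd_mem_varFree {i : τ} {a : σ → MvPowerSeries τ R}
    (h : ∀ k, a k ∈ varFree R i) (m : σ →₀ ℕ) : (m.prod fun k n => a k ^ n) ∈ varFree R i :=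
  prod_mem fun k _ => pow_mem (h k) _

theorem subst_mem_varFree {i : τ} {a : σ → MvPowerSeries τ R} (ha : HasSubst a)
    (h : ∀ k, a k ∈ varFree R i) (f : MvPowerSeries σ R) : subst a f ∈ varFree R i := by
  refine mem_varFree.mpr fun e he => ?_
  contrapose! he
  rw [coeff_subst ha]
  refine finsum_eq_zero_of_forall_eq_zero fun m => ?_
  rw [of_not_not fun hne => he (mem_varFree.mp (finsuppProd_mem_varFree h m) e hne), smul_zero]

theorem subst_congr_of_mem_varFree {i : σ} {a b : σ → MvPowerSeries τ R} (ha : HasSubst a)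
    (hb : HasSubst b) (hab : ∀ k ≠ i, a k = b k) {f : MvPowerSeries σ R} (hf : f ∈ varFree R i) :
    subst a f = subst b f := by
  ext e
  rw [coeff_subst ha, coeff_subst hb]
  refine finsum_congr fun m => ?_
  by_cases hm : coeff m f = 0
  · rw [hm, zero_smul, zero_smul]
  · congr 2
    refine Finsupp.prod_congr fun k hk => ?_
    rw [hab k fun hki => Finsupp.mem_support_iff.mp hk (hki ▸ mem_varFree.mp hf m hm)]

end VarFree

section DegreeIdeal

variable {σ R : Type*} [CommRing R]

theorem mem_weightIdeal_one {d : ℕ} {f : MvPowerSeries σ R} :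
    f ∈ weightIdeal 1 d ↔ ∀ m, coeff m f ≠ 0 → d ≤ m.degree := by
  simp_rw [mem_weightIdeal, Finsupp.degree_eq_weight_one]
  rfl

theorem coeff_eq_zero_of_mem_weightIdeal_one {d : ℕ} {f : MvPowerSeries σ R}
    (hf : f ∈ weightIdeal 1 d) {m : σ →₀ ℕ} (hm : m.degree < d) : coeff m f = 0 :=
  by_contra fun h => hm.not_ge (mem_weightIdeal_one.mp hf m h)

theorem mem_weightIdeal_one_one {f : MvPowerSeries σ R} :
    f ∈ weightIdeal 1 1 ↔ constantCoeff f = 0 :=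
  one_le_order_iff_constCoeff_eq_zero

theorem pow_sub_pow_mem_weightIdeal_add {n : ℕ} {v v' : MvPowerSeries σ R}
    (hv : v ∈ weightIdeal 1 1) (hv' : v' ∈ weightIdeal 1 1) (h : v - v' ∈ weightIdeal 1 n)
    (p : ℕ) : v ^ p - v' ^ p ∈ weightIdeal 1 (n + (p - 1)) := by
  rw [← (Commute.all v v').mul_geom_sum₂ p]
  refine mul_mem_weightIdeal h (sum_mem fun q hq => ?_)
  refine weightIdeal_anti 1 (b := q * 1 + (p - 1 - q) * 1) ?_
    (mul_mem_weightIdeal (pow_mem_weightIdeal hv _) (pow_mem_weightIdeal hv' _))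
  have := Finset.mem_range.mp hq
  omega

end DegreeIdeal

section Erase

variable {σ : Type*}

theorem degree_erase_add (m : σ →₀ ℕ) (i : σ) : m i + (m.erase i).degree = m.degree := by
  conv_rhs => rw [← Finsupp.single_add_erase i m]
  rw [map_add, Finsupp.degree_single]

theorem two_le_add_two_mul_degree_erase {m : σ →₀ ℕ} {i : σ} (h0 : m ≠ 0)
    (h1 : m ≠ Finsupp.single i 1) : 2 ≤ m i + 2 * (m.erase i).degree := by
  by_contra! hlt
  have herase : m.erase i = 0 := (Finsupp.degree_eq_zero_iff _).mp (by omega)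
  have hm := Finsupp.single_add_erase i m
  rw [herase, add_zero] at hm
  obtain hi | hi : m i = 0 ∨ m i = 1 := by omega
  · exact h0 (by rw [← hm, hi, Finsupp.single_zero])
  · exact h1 (by rw [← hm, hi])

theorem finsuppProd_update_pow [DecidableEq σ] {M : Type*} [CommMonoid M] (a : σ → M) (i : σ)
    (b : M) (m : σ →₀ ℕ) : (m.prod fun k n => Function.update a i b k ^ n) =
      b ^ m i * (m.erase i).prod fun k n => a k ^ n := by
  rw [← Finsupp.mul_prod_erase' m i (fun k n => Function.update a i b k ^ n) fun _ => pow_zero _,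
    Function.update_self]
  congr 1
  refine Finsupp.prod_congr fun k hk => ?_
  rw [Finsupp.support_erase, Finset.mem_erase] at hk
  rw [Function.update_of_ne hk.1]

end Erase

section ImplicitFunction

variable {σ R : Type*} [DecidableEq σ] [CommRing R] {i : σ}

theorem constantCoeff_update_X {v : MvPowerSeries σ R} (hv : constantCoeff v = 0) (k : σ) :
    constantCoeff (Function.update (X : σ → MvPowerSeries σ R) i v k) = 0 := by
  rcases eq_or_ne k i with rfl | h
  · rwa [Function.update_self]
  · rw [Function.update_of_ne h, constantCoeff_X]

theorem hasSubst_update_X [Finite σ] {v : MvPowerSeries σ R} (hv : constantCoeff v = 0) :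
    HasSubst (Function.update (X : σ → MvPowerSeries σ R) i v) :=
  hasSubst_of_constantCoeff_zero (constantCoeff_update_X hv)

theorem subst_update_X_mem_varFree [Finite σ] {v : MvPowerSeries σ R} (hv : constantCoeff v = 0)
    (hfree : v ∈ varFree R i) (H : MvPowerSeries σ R) :
    subst (Function.update X i v) H ∈ varFree R i := by
  refine subst_mem_varFree (hasSubst_update_X hv) (fun k => ?_) H
  rcases eq_or_ne k i with rfl | h
  · rwa [Function.update_self]
  · rw [Function.update_of_ne h]
    exact X_mem_varFree h

/-- The successive approximations of the solution `u` of the implicit equation `X i = H`. -/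
noncomputable def implicitIterate (i : σ) (H : MvPowerSeries σ R) : ℕ → MvPowerSeries σ R
  | 0 => 0
  | n + 1 => subst (Function.update X i (implicitIterate i H n)) H

/-- The formal solution of the implicit equation `X i = H`, where `H` has neither a constant term
nor a term linear in `X i`. The approximation of index `d + 1` is exact up to degree `d`. -/
noncomputable def implicitLimit (i : σ) (H : MvPowerSeries σ R) : MvPowerSeries σ R :=
  fun m => coeff m (implicitIterate i H (m.degree + 1))

variable [Finite σ] {H : MvPowerSeries σ R}

theorem subst_update_X_sub_subst_update_X_mem_weightIdeal
    (hH : coeff (Finsupp.single i 1) H = 0) {v v' : MvPowerSeries σ R} {n : ℕ}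
    (hv : constantCoeff v = 0) (hv' : constantCoeff v' = 0) (h : v - v' ∈ weightIdeal 1 n) :
    subst (Function.update X i v) H - subst (Function.update X i v') H ∈
      weightIdeal 1 (n + 1) := by
  refine subst_sub_subst_mem_weightIdeal (hasSubst_update_X hv) (hasSubst_update_X hv')
    fun m => ?_
  rw [finsuppProd_update_pow, finsuppProd_update_pow, ← smul_sub, ← sub_mul, smul_eq_C_mul]
  by_cases hm : coeff m H = 0
  · simp [hm]
  by_cases hi : m i = 0
  · simp [hi]
  have hdeg := two_le_add_two_mul_degree_erase (i := i) (m := m) (by rintro rfl; exact hi rfl)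
    (by rintro rfl; exact hm hH)
  have hrest : ((m.erase i).prod fun k n => (X k : MvPowerSeries σ R) ^ n) ∈
      weightIdeal 1 (m.erase i).degree := by
    rw [← monomial_one_eq]
    exact monomial_mem_weightIdeal (Finsupp.degree_eq_weight_one (R := ℕ) ▸ le_rfl) 1
  exact Ideal.mul_mem_left _ _ (weightIdeal_anti 1 (by omega) (mul_mem_weightIdeal
    (pow_sub_pow_mem_weightIdeal_add (mem_weightIdeal_one_one.mpr hv)
      (mem_weightIdeal_one_one.mpr hv') h (m i)) hrest))

theorem constantCoeff_implicitIterate (hH0 : constantCoeff H = 0) (n : ℕ) :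
    constantCoeff (implicitIterate i H n) = 0 := by
  induction n with
  | zero => exact map_zero _
  | succ n ih =>
    exact constantCoeff_subst_eq_zero (hasSubst_update_X ih) (constantCoeff_update_X ih) hH0

theorem implicitIterate_mem_varFree (hH0 : constantCoeff H = 0) (n : ℕ) :
    implicitIterate i H n ∈ varFree R i := by
  induction n with
  | zero => exact zero_mem _
  | succ n ih => exact subst_update_X_mem_varFree (constantCoeff_implicitIterate hH0 n) ih H

theorem implicitIterate_add_sub_mem_weightIdeal (hH0 : constantCoeff H = 0)
    (hH1 : coeff (Finsupp.single i 1) H = 0) (n k : ℕ) :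
    implicitIterate i H (n + k) - implicitIterate i H n ∈ weightIdeal 1 n := by
  induction n with
  | zero => rw [weightIdeal_zero]; exact Submodule.mem_top
  | succ n ih =>
    rw [Nat.succ_add]
    exact subst_update_X_sub_subst_update_X_mem_weightIdeal hH1
      (constantCoeff_implicitIterate hH0 _) (constantCoeff_implicitIterate hH0 _) ih

theorem coeff_implicitLimit (hH0 : constantCoeff H = 0)
    (hH1 : coeff (Finsupp.single i 1) H = 0) {n : ℕ} {m : σ →₀ ℕ} (h : m.degree < n) :
    coeff m (implicitLimit i H) = coeff m (implicitIterate i H n) := by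
  obtain ⟨k, rfl⟩ := Nat.exists_eq_add_of_le (Nat.succ_le_of_lt h)
  refine (sub_eq_zero.mp ?_).symm
  rw [coeff_apply (implicitLimit i H), implicitLimit, ← map_sub]
  exact coeff_eq_zero_of_mem_weightIdeal_one
    (implicitIterate_add_sub_mem_weightIdeal hH0 hH1 (m.degree + 1) k) (Nat.lt_succ_self _)

theorem implicitLimit_sub_implicitIterate_mem_weightIdeal (hH0 : constantCoeff H = 0)
    (hH1 : coeff (Finsupp.single i 1) H = 0) (n : ℕ) :
    implicitLimit i H - implicitIterate i H n ∈ weightIdeal 1 n := by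
  refine mem_weightIdeal_one.mpr fun m hm => ?_
  by_contra! h
  exact hm (by rw [map_sub, coeff_implicitLimit hH0 hH1 h, sub_self])

theorem implicitLimit_mem_varFree (hH0 : constantCoeff H = 0) :
    implicitLimit i H ∈ varFree R i := by
  refine mem_varFree.mpr fun m hm => ?_
  rw [coeff_apply, implicitLimit] at hm
  exact mem_varFree.mp (implicitIterate_mem_varFree hH0 _) m hm

theorem constantCoeff_implicitLimit (hH0 : constantCoeff H = 0) :
    constantCoeff (implicitLimit i H) = 0 := by
  rw [← coeff_zero_eq_constantCoeff_apply, coeff_apply, implicitLimit,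
    coeff_zero_eq_constantCoeff_apply, constantCoeff_implicitIterate hH0]

theorem subst_implicitLimit (hH0 : constantCoeff H = 0)
    (hH1 : coeff (Finsupp.single i 1) H = 0) :
    subst (Function.update X i (implicitLimit i H)) H = implicitLimit i H := by
  ext m
  set n := m.degree + 1
  have hlim := subst_update_X_sub_subst_update_X_mem_weightIdeal hH1
    (constantCoeff_implicitLimit hH0) (constantCoeff_implicitIterate hH0 n)
    (implicitLimit_sub_implicitIterate_mem_weightIdeal hH0 hH1 n)
  have hcoeff := coeff_eq_zero_of_mem_weightIdeal_one hlim (m := m) (by omega)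
  rw [map_sub, sub_eq_zero] at hcoeff
  rw [hcoeff, coeff_implicitLimit hH0 hH1 (m := m) (n := n + 1) (by omega)]
  rfl

end ImplicitFunction

section ImplicitFunctionNorm

variable {σ R : Type*} [DecidableEq σ] [NormedCommRing R] [NormOneClass R] {i : σ}
  {H : MvPowerSeries σ R}

theorem polydiscNorm_update_X (ρ : σ → ℝ≥0∞) (v : MvPowerSeries σ R) :
    (fun k => polydiscNorm ρ (Function.update (X : σ → MvPowerSeries σ R) i v k)) =
      Function.update ρ i (polydiscNorm ρ v) := by
  funext k
  rw [Function.apply_update (fun _ => polydiscNorm ρ)]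
  simp only [polydiscNorm_X]

variable [Finite σ]

-- The radius `t ^ 2 * r` makes the terms of `H` that are linear in the other variables as small as
-- those that are quadratic in `X i`, so that the iterates stay in the ball of radius `t * r`.
theorem polydiscNorm_implicitIterate_le (hH0 : constantCoeff H = 0)
    (hH1 : coeff (Finsupp.single i 1) H = 0) {r t : ℝ≥0∞} (ht : t ≤ 1)
    (hH : t * polydiscNorm (fun _ => r) H ≤ r) (n : ℕ) :
    polydiscNorm (fun _ => t ^ 2 * r) (implicitIterate i H n) ≤ t * r := by
  induction n with
  | zero => simp [implicitIterate, polydiscNorm]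
  | succ n ih =>
    refine (polydiscNorm_subst_le _
      (hasSubst_update_X (constantCoeff_implicitIterate hH0 n)) H).trans ?_
    refine le_trans ?_ (mul_le_mul_right hH t)
    rw [polydiscNorm_update_X]
    generalize polydiscNorm _ (implicitIterate i H n) = N at ih ⊢
    rw [← mul_assoc, ← sq, polydiscNorm, polydiscNorm, ← ENNReal.tsum_mul_left]
    refine ENNReal.tsum_le_tsum fun m => ?_
    by_cases hm : coeff m H = 0
    · simp [hm]
    have hdeg := two_le_add_two_mul_degree_erase (i := i) (m := m)
      (by rintro rfl; exact hm hH0) (by rintro rfl; exact hm hH1)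
    rw [finsuppProd_update_pow, finsuppProd_const_pow, finsuppProd_const_pow,
      ← degree_erase_add m i]
    calc ‖coeff m H‖ₑ * (N ^ m i * (t ^ 2 * r) ^ (m.erase i).degree)
        ≤ ‖coeff m H‖ₑ * ((t * r) ^ m i * (t ^ 2 * r) ^ (m.erase i).degree) := by gcongr
      _ = t ^ (m i + 2 * (m.erase i).degree) *
            (‖coeff m H‖ₑ * r ^ (m i + (m.erase i).degree)) := by ring
      _ ≤ t ^ 2 * (‖coeff m H‖ₑ * r ^ (m i + (m.erase i).degree)) := by
          gcongr ?_ * _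
          exact pow_le_pow_right_of_le_one' ht hdeg

theorem exists_polydiscNorm_implicitLimit_ne_top (hH0 : constantCoeff H = 0)
    (hH1 : coeff (Finsupp.single i 1) H = 0) {r : ℝ≥0} (hr : 0 < r)
    (hH : polydiscNorm (fun _ => r) H ≠ ∞) :
    ∃ s : ℝ≥0, 0 < s ∧ polydiscNorm (fun _ => s) (implicitLimit i H) ≠ ∞ := by
  obtain ⟨t, ht0, ht1, htr⟩ := exists_pos_le_one_mul_le hH hr
  refine ⟨t ^ 2 * r, by positivity, ne_top_of_le_ne_top (b := (t : ℝ≥0∞) * r) (by finiteness) ?_⟩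
  rw [polydiscNorm, ENNReal.tsum_eq_iSup_sum]
  refine iSup_le fun S => ?_
  calc ∑ m ∈ S, ‖coeff m (implicitLimit i H)‖ₑ *
        m.prod (fun _ n => ((t ^ 2 * r : ℝ≥0) : ℝ≥0∞) ^ n)
      = ∑ m ∈ S, ‖coeff m (implicitIterate i H (S.sup Finsupp.degree + 1))‖ₑ *
          m.prod fun _ n => ((t : ℝ≥0∞) ^ 2 * r) ^ n :=
        Finset.sum_congr rfl fun m hm => by
          rw [coeff_implicitLimit hH0 hH1 (Nat.lt_succ_of_le (Finset.le_sup hm))]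
          push_cast
          rfl
    _ ≤ polydiscNorm (fun _ => (t : ℝ≥0∞) ^ 2 * r)
          (implicitIterate i H (S.sup Finsupp.degree + 1)) := ENNReal.sum_le_tsum S
    _ ≤ t * r := polydiscNorm_implicitIterate_le hH0 hH1 (mod_cast ht1) htr _

end ImplicitFunctionNorm

namespace ConvergentSeries

theorem isConvergent_X (k : Fin 2) : IsConvergent (X k) := by
  rw [← MvPolynomial.coe_X]
  exact isConvergent_coe _

theorem isConvergent_C (c : ℂ) : IsConvergent (C c) := ConvergentSeries.algebraMap_mem c

theorem exists_subst_update_eq_zero {i : Fin 2} {G : MvPowerSeries (Fin 2) ℂ}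
    (hG : IsConvergent G) (h0 : constantCoeff G = 0) (h1 : coeff (Finsupp.single i 1) G ≠ 0) :
    ∃ u : MvPowerSeries (Fin 2) ℂ, IsConvergent u ∧ constantCoeff u = 0 ∧ u ∈ varFree ℂ i ∧
      subst (Function.update X i u) G = 0 := by
  set c := (coeff (Finsupp.single i 1) G)⁻¹ with hc
  set H : MvPowerSeries (Fin 2) ℂ := X i - C c * G with hH
  have hH0 : constantCoeff H = 0 := by simp [hH, h0]
  have hH1 : coeff (Finsupp.single i 1) H = 0 := by
    rw [hH, map_sub, coeff_C_mul, hc, inv_mul_cancel₀ h1, X, coeff_monomial_same, sub_self]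
  have hHc : IsConvergent H :=
    ConvergentSeries.sub_mem (isConvergent_X i) (isConvergent_mul (isConvergent_C c) hG)
  obtain ⟨r, hr, hHr⟩ := isConvergent_iff_polydiscNorm_ne_top.mp hHc
  have hu0 := constantCoeff_implicitLimit (i := i) hH0
  refine ⟨implicitLimit i H, isConvergent_iff_polydiscNorm_ne_top.mpr
    (exists_polydiscNorm_implicitLimit_ne_top hH0 hH1 hr hHr), hu0,
    implicitLimit_mem_varFree hH0, ?_⟩
  have hsol := subst_implicitLimit hH0 hH1
  have hs := hasSubst_update_X (i := i) hu0
  nth_rw 2 [hH] at hsol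
  rw [subst_sub hs, subst_mul hs, subst_C, subst_X hs, Function.update_self, sub_eq_self] at hsol
  exact (mul_eq_zero.mp hsol).resolve_left (by simpa [hc] using h1)

end ConvergentSeries

/-! ### Shears -/

section PolynomialAeval

theorem aeval_pow_mul_of_isWeightedHomogeneous {σ R A : Type*} [CommSemiring R] [CommSemiring A]
    [Algebra R A] {w : σ → ℕ} {p : MvPolynomial σ R} {n : ℕ}
    (hp : MvPolynomial.IsWeightedHomogeneous w p n) (s : σ → A) (t : A) :
    MvPolynomial.aeval (fun k => t ^ w k * s k) p = t ^ n * MvPolynomial.aeval s p := by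
  rw [MvPolynomial.aeval_def, MvPolynomial.aeval_def, MvPolynomial.eval₂_eq,
    MvPolynomial.eval₂_eq, Finset.mul_sum]
  refine Finset.sum_congr rfl fun m hm => ?_
  have hprod : t ^ n = ∏ k ∈ m.support, t ^ (w k * m k) := by
    rw [← hp (MvPolynomial.mem_support_iff.mp hm), Finset.prod_pow_eq_pow_sum,
      Finsupp.weight_apply, Finsupp.sum]
    simp only [smul_eq_mul, mul_comm (w _)]
  simp only [mul_pow, Finset.prod_mul_distrib, hprod, ← pow_mul]
  ring

theorem isWeightedHomogeneous_pderiv {σ R : Type*} [CommSemiring R] {w : σ → ℕ}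
    {p : MvPolynomial σ R} {n : ℕ} (hp : MvPolynomial.IsWeightedHomogeneous w p n) (k : σ) :
    MvPolynomial.IsWeightedHomogeneous w (MvPolynomial.pderiv k p) (n - w k) := by
  intro m hm
  rw [MvPolynomial.coeff_pderiv] at hm
  have hweight := hp (left_ne_zero_of_mul hm)
  rw [map_add, Finsupp.weight_single, one_smul] at hweight
  omega

theorem derivation_aeval {σ R A : Type*} [Fintype σ] [CommSemiring R] [CommSemiring A] [Algebra R A]
    (D : Derivation R A A) (s : σ → A) (p : MvPolynomial σ R) :
    D (MvPolynomial.aeval s p) = ∑ k, MvPolynomial.aeval s (MvPolynomial.pderiv k p) * D (s k) := by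
  induction p using MvPolynomial.induction_on with
  | C c => simp
  | add p q hp hq => simp only [map_add, hp, hq, add_mul, Finset.sum_add_distrib]
  | mul_X p k hp =>
    classical
    simp only [map_mul, Derivation.leibniz, hp, MvPolynomial.aeval_X, smul_eq_mul, map_add,
      MvPolynomial.pderiv_X, add_mul, Finset.sum_add_distrib, Finset.mul_sum]
    congr 1
    · rw [Finset.sum_eq_single k]
      · simp
      · intro l _ hl
        simp [hl]
      · simp
    · simp only [mul_assoc]

theorem coe_aeval_eq_aeval_coe {σ τ R : Type*} [CommRing R] (s : σ → MvPolynomial τ R)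
    (p : MvPolynomial σ R) :
    (MvPolynomial.aeval s p : MvPowerSeries τ R) =
      MvPolynomial.aeval (fun k => (s k : MvPowerSeries τ R)) p := by
  simpa using! DFunLike.congr_fun (MvPolynomial.comp_aeval (R := R) s
    (MvPolynomial.coeToMvPowerSeries.algHom (R := R) R)) p

theorem mem_span_pderiv_of_isWeightedHomogeneous {σ K : Type*} [Finite σ] [Field K] [CharZero K]
    {w : σ → ℕ} {p : MvPolynomial σ K} {n : ℕ} (hp : MvPolynomial.IsWeightedHomogeneous w p n)
    (hn : n ≠ 0) : p ∈ Ideal.span (Set.range fun k => MvPolynomial.pderiv k p) := by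
  have := Fintype.ofFinite σ
  have hsmul : (n : K) • p ∈ Ideal.span (Set.range fun k => MvPolynomial.pderiv k p) := by
    rw [Nat.cast_smul_eq_nsmul, ← hp.sum_weight_X_mul_pderiv]
    exact sum_mem fun k _ => nsmul_mem
      (Ideal.mul_mem_left _ _ (Ideal.subset_span (Set.mem_range_self k))) _
  simpa [smul_smul, hn] using Submodule.smul_of_tower_mem _ (n : K)⁻¹ hsmul

end PolynomialAeval

theorem pderiv_eq_zero_of_mem_varFree {σ R : Type*} [CommRing R] {i : σ}
    {p : MvPolynomial σ R}
    (hp : (p : MvPowerSeries σ R) ∈ varFree R i) : MvPolynomial.pderiv i p = 0 := by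
  refine MvPolynomial.pderiv_eq_zero_of_notMem_vars fun hi => ?_
  obtain ⟨m, hm, hmi⟩ := (MvPolynomial.mem_vars_iff_mem_support i).mp hi
  rw [MvPolynomial.mem_support_iff, ← MvPolynomial.coeff_coe] at hm
  exact Finsupp.mem_support_iff.mp hmi (mem_varFree.mp hp m hm)

section Shear

variable {σ R : Type*} [DecidableEq σ] [CommRing R] {i : σ}

/-- The substitution `X i ↦ X i + φ`, leaving the other variables unchanged. -/
noncomputable def shear (i : σ) (φ : MvPowerSeries σ R) : σ → MvPowerSeries σ R :=
  Function.update X i (X i + φ)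

theorem shear_self (φ : MvPowerSeries σ R) : shear i φ i = X i + φ := Function.update_self ..

theorem shear_of_ne {k : σ} (hk : k ≠ i) (φ : MvPowerSeries σ R) : shear i φ k = X k :=
  Function.update_of_ne hk ..

theorem constantCoeff_shear {φ : MvPowerSeries σ R} (hφ : constantCoeff φ = 0) (k : σ) :
    constantCoeff (shear i φ k) = 0 :=
  constantCoeff_update_X (by rw [map_add, constantCoeff_X, hφ, add_zero]) k

theorem hasSubst_shear [Finite σ] {φ : MvPowerSeries σ R} (hφ : constantCoeff φ = 0) :
    HasSubst (shear i φ) :=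
  hasSubst_of_constantCoeff_zero (constantCoeff_shear hφ)

theorem subst_shear_subst_shear [Finite σ] {φ ψ : MvPowerSeries σ R}
    (hφ0 : constantCoeff φ = 0) (hφ : φ ∈ varFree R i) (hφψ : φ + ψ = 0) (f : MvPowerSeries σ R) :
    subst (shear i ψ) (subst (shear i φ) f) = f := by
  have hψ0 : constantCoeff ψ = 0 := by rw [eq_neg_of_add_eq_zero_right hφψ, map_neg, hφ0, neg_zero]
  have hs := hasSubst_shear (i := i) hψ0
  rw [subst_comp_subst_apply (hasSubst_shear hφ0) hs]
  have hcomp : (fun k => subst (shear i ψ) (shear i φ k)) = X := by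
    funext k
    rcases eq_or_ne k i with rfl | hk
    · rw [shear_self, subst_add hs, subst_X hs, shear_self,
        subst_congr_of_mem_varFree hs HasSubst.X (fun l hl => shear_of_ne hl ψ) hφ, subst_self,
        id, add_assoc, add_comm ψ, hφψ, add_zero]
    · rw [shear_of_ne hk, subst_X hs, shear_of_ne hk]
  rw [hcomp, subst_self, id]

/-- The polynomial substitution `X i ↦ X i + p`, leaving the other variables unchanged. -/
noncomputable def polyShear (i : σ) (p : MvPolynomial σ R) : σ → MvPolynomial σ R :=
  Function.update MvPolynomial.X i (MvPolynomial.X i + p)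

theorem polyShear_self (p : MvPolynomial σ R) : polyShear i p i = MvPolynomial.X i + p :=
  Function.update_self ..

theorem polyShear_of_ne {k : σ} (hk : k ≠ i) (p : MvPolynomial σ R) :
    polyShear i p k = MvPolynomial.X k :=
  Function.update_of_ne hk ..

theorem coe_polyShear (p : MvPolynomial σ R) (k : σ) :
    (polyShear i p k : MvPowerSeries σ R) = shear i (p : MvPowerSeries σ R) k := by
  rcases eq_or_ne k i with rfl | hk
  · rw [polyShear_self, shear_self, MvPolynomial.coe_add, MvPolynomial.coe_X]
  · rw [polyShear_of_ne hk, shear_of_ne hk, MvPolynomial.coe_X]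

theorem coe_aeval_polyShear (p q : MvPolynomial σ R) :
    (MvPolynomial.aeval (polyShear i p) q : MvPowerSeries σ R) =
      subst (shear i (p : MvPowerSeries σ R)) (q : MvPowerSeries σ R) := by
  rw [subst_coe, coe_aeval_eq_aeval_coe]
  exact congrArg (MvPolynomial.aeval · q) (funext (coe_polyShear p))

theorem pderiv_aeval_polyShear [Finite σ] (p q : MvPolynomial σ R) (k : σ) :
    MvPolynomial.pderiv k (MvPolynomial.aeval (polyShear i p) q) =
      MvPolynomial.aeval (polyShear i p) (MvPolynomial.pderiv k q) +
        MvPolynomial.aeval (polyShear i p) (MvPolynomial.pderiv i q) *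
          MvPolynomial.pderiv k p := by
  cases nonempty_fintype σ
  have hX (l : σ) : MvPolynomial.pderiv k (polyShear i p l) =
      (if l = k then 1 else 0) + if l = i then MvPolynomial.pderiv k p else 0 := by
    rcases eq_or_ne l i with rfl | hl
    · rw [polyShear_self, map_add, MvPolynomial.pderiv_X, Pi.single_apply, if_pos rfl]
    · rw [polyShear_of_ne hl, MvPolynomial.pderiv_X, Pi.single_apply, if_neg hl, add_zero]
  simp only [derivation_aeval, hX, mul_add, mul_ite, mul_one, mul_zero, Finset.sum_add_distrib,
    Finset.sum_ite_eq', Finset.mem_univ, if_true]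

theorem aeval_polyShear_pderiv_mem [Finite σ] {p q : MvPolynomial σ R}
    {I : Ideal (MvPolynomial σ R)} (hp : MvPolynomial.pderiv i p = 0)
    (hI : ∀ k, MvPolynomial.pderiv k (MvPolynomial.aeval (polyShear i p) q) ∈ I) (k : σ) :
    MvPolynomial.aeval (polyShear i p) (MvPolynomial.pderiv k q) ∈ I := by
  have hi : MvPolynomial.aeval (polyShear i p) (MvPolynomial.pderiv i q) ∈ I := by
    simpa only [pderiv_aeval_polyShear, hp, mul_zero, add_zero] using hI i
  have hk := hI k
  rw [pderiv_aeval_polyShear] at hk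
  exact (I.add_mem_iff_left (I.mul_mem_right _ hi)).mp hk

end Shear

theorem exists_algebraMap_eq_of_finite {K A B : Type*} [Field K] [IsAlgClosed K] [CommRing A]
    [Algebra K A] [Module.Finite K A] [CommRing B] [IsDomain B] [Algebra K B] (l : A →ₐ[K] B)
    (x : A) : ∃ c : K, algebraMap K B c = l x := by
  have : Module.Finite K l.range :=
    Module.Finite.of_surjective l.rangeRestrict.toLinearMap l.rangeRestrict_surjective
  obtain ⟨c, hc⟩ := (IsAlgClosed.algebraMap_bijective_of_isIntegral (k := K) (K := l.range)).2
    ⟨l x, x, rfl⟩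
  exact ⟨c, congrArg Subtype.val hc⟩

namespace ConvergentSeries

theorem coe_ofPoly (p : MvPolynomial (Fin 2) ℂ) :
    (ofPoly p : MvPowerSeries (Fin 2) ℂ) = (p : MvPowerSeries (Fin 2) ℂ) := rfl

theorem partialDeriv_ofPoly (k : Fin 2) (p : MvPolynomial (Fin 2) ℂ) :
    partialDeriv k (ofPoly p) = ofPoly (MvPolynomial.pderiv k p) :=
  Subtype.ext (pderiv_coe p)

theorem ofPoly_mem_jacobianIdeal {p q : MvPolynomial (Fin 2) ℂ}
    (h : p ∈ Ideal.span (Set.range fun k => MvPolynomial.pderiv k q)) :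
    ofPoly p ∈ jacobianIdeal (ofPoly q) := by
  obtain ⟨a, rfl⟩ := Ideal.mem_span_range_iff_exists_fun.mp h
  have hsum : ofPoly (∑ k, a k * MvPolynomial.pderiv k q) =
      ∑ k, ofPoly (a k) * partialDeriv k (ofPoly q) := by
    refine Subtype.ext ?_
    simp only [Fin.sum_univ_two, partialDeriv_ofPoly, coe_ofPoly, MvPolynomial.coe_add,
      MvPolynomial.coe_mul, Subalgebra.coe_add, Subalgebra.coe_mul]
  rw [hsum]
  exact sum_mem fun k _ => Ideal.mul_mem_left _ _ (Ideal.subset_span ⟨k, rfl⟩)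

theorem eq_zero_of_forall_eval_pderiv_eq_zero {w : Fin 2 → ℕ} (hw : ∀ k, 0 < w k)
    {p : MvPolynomial (Fin 2) ℂ} {n : ℕ} (hp : MvPolynomial.IsWeightedHomogeneous w p n)
    (hM : HasFiniteMilnorNumber (ofPoly p)) {P : Fin 2 → ℂ}
    (hP : ∀ k, MvPolynomial.eval P (MvPolynomial.pderiv k p) = 0) : P = 0 := by
  set a : Fin 2 → MvPowerSeries Unit ℂ := fun k => X () ^ w k * C (P k) with ha
  have ha0 (k) : constantCoeff (a k) = 0 := by simp [ha, (hw k).ne']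
  have hs : HasSubst a := hasSubst_of_constantCoeff_zero ha0
  let e : ConvergentSeries →ₐ[ℂ] MvPowerSeries Unit ℂ :=
    (substAlgHom (R := ℂ) hs).comp ConvergentSeries.val
  have he (q : MvPolynomial (Fin 2) ℂ) : e (ofPoly q) = MvPolynomial.aeval a q :=
    substAlgHom_coe hs q
  have hC : (fun k => C (P k) : Fin 2 → MvPowerSeries Unit ℂ) = algebraMap ℂ _ ∘ P := rfl
  have hJ : jacobianIdeal (ofPoly p) ≤ RingHom.ker e := by
    rw [jacobianIdeal, Ideal.span_le]
    rintro _ ⟨k, rfl⟩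
    refine RingHom.mem_ker.mpr ?_
    beta_reduce
    rw [partialDeriv_ofPoly, he, ha,
      aeval_pow_mul_of_isWeightedHomogeneous (isWeightedHomogeneous_pderiv hp k)
        (fun k => C (P k)) (X ()), hC, MvPolynomial.aeval_algebraMap_apply,
      MvPolynomial.aeval_eq_eval, hP, map_zero, mul_zero]
  have : Module.Finite ℂ (ConvergentSeries ⧸ jacobianIdeal (ofPoly p)) := hM
  have : IsDomain (MvPowerSeries Unit ℂ) := NoZeroDivisors.to_isDomain _
  funext j
  obtain ⟨c, hc⟩ := exists_algebraMap_eq_of_finite (Ideal.Quotient.liftₐ _ e hJ)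
    (Ideal.Quotient.mk _ (ofPoly (MvPolynomial.X j)))
  have hcj : C c = a j := hc.trans ((he _).trans (MvPolynomial.aeval_X a j))
  obtain rfl : c = 0 := by rw [← constantCoeff_C (σ := Unit) c, hcj, ha0]
  have hX : (X () : MvPowerSeries Unit ℂ) ≠ 0 := PowerSeries.X_ne_zero
  rw [map_zero] at hcj
  simpa [pow_ne_zero _ hX] using mul_eq_zero.mp hcj.symm

theorem HasFiniteMilnorNumber.of_map_partialDeriv_mem {f g : ConvergentSeries}
    (hf : HasFiniteMilnorNumber f) (Φ : ConvergentSeries ≃ₐ[ℂ] ConvergentSeries)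
    (hΦ : ∀ k, Φ (partialDeriv k f) ∈ jacobianIdeal g) : HasFiniteMilnorNumber g := by
  have hle : jacobianIdeal f ≤
      (jacobianIdeal g).comap (Φ : ConvergentSeries →ₐ[ℂ] ConvergentSeries) := by
    rw [jacobianIdeal, Ideal.span_le]
    rintro _ ⟨k, rfl⟩
    exact hΦ k
  have : Module.Finite ℂ (ConvergentSeries ⧸ jacobianIdeal f) := hf
  exact Module.Finite.of_surjective (Ideal.quotientMapₐ _ _ hle).toLinearMap
    (Ideal.quotientMap_surjective (H := hle) Φ.surjective)

theorem isConvergent_shear {i : Fin 2} {φ : MvPowerSeries (Fin 2) ℂ} (hφ : IsConvergent φ)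
    (k : Fin 2) : IsConvergent (shear i φ k) := by
  rcases eq_or_ne k i with rfl | h
  · rw [shear_self]
    exact isConvergent_add (isConvergent_X _) hφ
  · rw [shear_of_ne h]
    exact isConvergent_X _

/-- The shear `X i ↦ X i + φ`, with `φ` not involving `X i`, as an automorphism of the ring of
germs. -/
noncomputable def shearEquiv (i : Fin 2) (φ : ConvergentSeries)
    (hφ0 : constantCoeff (φ : MvPowerSeries (Fin 2) ℂ) = 0)
    (hφ : (φ : MvPowerSeries (Fin 2) ℂ) ∈ varFree ℂ i) :
    ConvergentSeries ≃ₐ[ℂ] ConvergentSeries :=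
  have hneg0 : constantCoeff (-φ : MvPowerSeries (Fin 2) ℂ) = 0 := by rw [map_neg, hφ0, neg_zero]
  AlgEquiv.ofAlgHom
    (substHom (fun k => ⟨shear i φ k, isConvergent_shear φ.2 k⟩) (constantCoeff_shear hφ0))
    (substHom (fun k => ⟨shear i (-φ) k, isConvergent_shear (neg_mem φ.2) k⟩)
      (constantCoeff_shear hneg0))
    (AlgHom.ext fun f => Subtype.ext (by
      rw [AlgHom.comp_apply, coe_substHom, coe_substHom]
      exact subst_shear_subst_shear hneg0 (neg_mem hφ) (neg_add_cancel _) _))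
    (AlgHom.ext fun f => Subtype.ext (by
      rw [AlgHom.comp_apply, coe_substHom, coe_substHom]
      exact subst_shear_subst_shear hφ0 hφ (add_neg_cancel _) _))

theorem coe_shearEquiv {i : Fin 2} (φ : ConvergentSeries)
    (hφ0 : constantCoeff (φ : MvPowerSeries (Fin 2) ℂ) = 0)
    (hφ : (φ : MvPowerSeries (Fin 2) ℂ) ∈ varFree ℂ i) (f : ConvergentSeries) :
    (shearEquiv i φ hφ0 hφ f : MvPowerSeries (Fin 2) ℂ) =
      subst (shear i (φ : MvPowerSeries (Fin 2) ℂ)) (f : MvPowerSeries (Fin 2) ℂ) :=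
  coe_substHom _ (constantCoeff_shear hφ0) _

theorem hasFiniteMilnorNumber_of_aeval_polyShear {i : Fin 2} {w : Fin 2 → ℕ} {n : ℕ}
    {p f q r : MvPolynomial (Fin 2) ℂ} (hp0 : constantCoeff (p : MvPowerSeries (Fin 2) ℂ) = 0)
    (hp : (p : MvPowerSeries (Fin 2) ℂ) ∈ varFree ℂ i)
    (hq : MvPolynomial.IsWeightedHomogeneous w q n) (hn : n ≠ 0)
    (hfq : MvPolynomial.aeval (polyShear i p) f = r * q)
    (hM : HasFiniteMilnorNumber (ofPoly f)) : HasFiniteMilnorNumber (ofPoly q) := by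
  have hφ0 : constantCoeff (ofPoly p : MvPowerSeries (Fin 2) ℂ) = 0 := hp0
  have hφ : (ofPoly p : MvPowerSeries (Fin 2) ℂ) ∈ varFree ℂ i := hp
  refine hM.of_map_partialDeriv_mem (shearEquiv i (ofPoly p) hφ0 hφ) fun k => ?_
  have himage : shearEquiv i (ofPoly p) hφ0 hφ (partialDeriv k (ofPoly f)) =
      ofPoly (MvPolynomial.aeval (polyShear i p) (MvPolynomial.pderiv k f)) := by
    refine Subtype.ext ?_
    rw [coe_shearEquiv, partialDeriv_ofPoly, coe_ofPoly, coe_ofPoly, coe_ofPoly,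
      coe_aeval_polyShear]
  rw [himage]
  refine ofPoly_mem_jacobianIdeal
    (aeval_polyShear_pderiv_mem (pderiv_eq_zero_of_mem_varFree hp) (fun l => ?_) k)
  rw [hfq, Derivation.leibniz]
  exact add_mem (Ideal.mul_mem_left _ _ (Ideal.subset_span ⟨l, rfl⟩))
    (Ideal.mul_mem_right _ _ (mem_span_pderiv_of_isWeightedHomogeneous hq hn))

end ConvergentSeries

end PowerSeries

/-! ### Facets and their weights -/

section NewtonBoundary

open scoped Matrix

theorem weight_fin_two (w : Fin 2 → ℕ) (m : Fin 2 →₀ ℕ) {i j : Fin 2} (hij : i ≠ j) :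
    Finsupp.weight w m = w i * m i + w j * m j := by
  rw [Finsupp.weight_apply, Finsupp.sum_fintype _ _ (by simp), Fin.sum_univ_two]
  fin_cases i <;> fin_cases j <;> simp_all [add_comm, mul_comm]

theorem finsupp_ext_fin_two {m n : Fin 2 →₀ ℕ} {i j : Fin 2} (hij : i ≠ j) (hi : m i = n i)
    (hj : m j = n j) : m = n := by
  ext k
  obtain rfl | rfl : k = i ∨ k = j := by lia
  · exact hi
  · exact hj

theorem convexHull_inter_hyperplane {E : Type*} [AddCommGroup E] [Module ℝ E] (l : E →ₗ[ℝ] ℝ)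
    {S : Set E} {d : ℝ} (hS : ∀ x ∈ S, d ≤ l x) :
    convexHull ℝ S ∩ {x | l x = d} = convexHull ℝ (S ∩ {x | l x = d}) := by
  set K := convexHull ℝ (S ∩ {x | l x = d})
  have hconv : Convex ℝ {x | d ≤ l x ∧ (l x = d → x ∈ K)} := by
    refine convex_iff_forall_pos.mpr fun x hx y hy a b ha hb hab => ?_
    have hl : l (a • x + b • y) - d = a * (l x - d) + b * (l y - d) := by
      simp only [map_add, map_smul, smul_eq_mul]
      linear_combination d * hab
    have hax := mul_nonneg ha.le (sub_nonneg.mpr hx.1)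
    have hby := mul_nonneg hb.le (sub_nonneg.mpr hy.1)
    refine ⟨by linarith, fun h => ?_⟩
    rw [h, sub_self, eq_comm, add_eq_zero_iff_of_nonneg hax hby, mul_eq_zero_iff_left ha.ne',
      mul_eq_zero_iff_left hb.ne', sub_eq_zero, sub_eq_zero] at hl
    exact convex_convexHull ℝ _ (hx.2 hl.1) (hy.2 hl.2) ha.le hb.le hab
  have hS' : S ⊆ {x | d ≤ l x ∧ (l x = d → x ∈ K)} := fun x hx =>
    ⟨hS x hx, fun h => subset_convexHull ℝ _ ⟨hx, h⟩⟩
  refine Set.Subset.antisymm (fun x hx => (convexHull_min hS' hconv hx.1).2 hx.2) ?_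
  exact convexHull_min (Set.inter_subset_inter_left _ (subset_convexHull ℝ S))
    ((convex_convexHull ℝ S).inter (convex_hyperplane l.isLinear d))

theorem exists_coprime_of_mul_eq_mul {u v : ℝ} (hu : 0 < u) {a b : ℕ} (ha : 0 < a) (hb : 0 < b)
    (h : u * a = v * b) : ∃ p q : ℕ, 0 < p ∧ 0 < q ∧ p.Coprime q ∧
      ∃ κ : ℝ, 0 < κ ∧ u = κ * p ∧ v = κ * q := by
  obtain ⟨g, p, q, -, hpq, rfl, rfl⟩ := Nat.exists_coprime' (m := b) (n := a)
    (Nat.gcd_pos_of_pos_left _ hb)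
  have hg : (g : ℝ) ≠ 0 := Nat.cast_ne_zero.mpr (right_ne_zero_of_mul ha.ne')
  have hp : 0 < p := Nat.pos_of_mul_pos_right hb
  have hpR : (0 : ℝ) < p := Nat.cast_pos.mpr hp
  refine ⟨p, q, hp, Nat.pos_of_mul_pos_right ha, hpq, u / p, div_pos hu hpR,
    (div_mul_cancel₀ u hpR.ne').symm, ?_⟩
  rw [div_mul_eq_mul_div, eq_div_iff hpR.ne']
  refine mul_right_cancel₀ hg ?_
  push_cast at h
  linear_combination -h

namespace ConvergentSeries

open MvPowerSeries

theorem exponentPoint_injective : Function.Injective exponentPoint := fun _ _ h =>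
  DFunLike.coe_injective (funext fun k => Nat.cast_injective (congrFun h k))

theorem natCast_weight (w : Fin 2 → ℕ) (m : Fin 2 →₀ ℕ) :
    (Finsupp.weight w m : ℝ) = (fun k => (w k : ℝ)) ⬝ᵥ exponentPoint m := by
  rw [weight_fin_two w m zero_ne_one, dotProduct, Fin.sum_univ_two]
  push_cast
  rfl

theorem exists_coprime_of_dotProduct_eq {c : Fin 2 → ℝ} (hc : ∀ k, 0 < c k) {m n : Fin 2 →₀ ℕ}
    (hmn : m ≠ n) (h : c ⬝ᵥ exponentPoint m = c ⬝ᵥ exponentPoint n) :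
    ∃ w : Fin 2 → ℕ, (∀ k, 0 < w k) ∧ (w 0).Coprime (w 1) ∧
      ∃ κ : ℝ, 0 < κ ∧ c = κ • fun k => (w k : ℝ) := by
  wlog hlt : n 0 < m 0 generalizing m n
  · rcases (not_lt.mp hlt).lt_or_eq with hlt' | heq
    · exact this hmn.symm h.symm hlt'
    · refine absurd (finsupp_ext_fin_two zero_ne_one heq ?_) hmn
      simpa [dotProduct, exponentPoint, heq, (hc 1).ne'] using h
  have hsub : c 0 * ((m 0 : ℝ) - n 0) = c 1 * ((n 1 : ℝ) - m 1) := by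
    simp only [dotProduct, exponentPoint, Fin.sum_univ_two] at h
    linear_combination h
  have hlt' : m 1 < n 1 := by
    have := pos_of_mul_pos_right (hsub ▸ mul_pos (hc 0) (sub_pos.mpr (Nat.cast_lt.mpr hlt)))
      (hc 1).le
    exact Nat.cast_lt.mp (sub_pos.mp this)
  rw [← Nat.cast_sub hlt.le, ← Nat.cast_sub hlt'.le] at hsub
  obtain ⟨p, q, hp, hq, hpq, κ, hκ, h0, h1⟩ := exists_coprime_of_mul_eq_mul (hc 0)
    (Nat.sub_pos_of_lt hlt) (Nat.sub_pos_of_lt hlt') hsub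
  refine ⟨![p, q], Fin.forall_fin_two.mpr ⟨hp, hq⟩, hpq, κ, hκ, funext ?_⟩
  exact Fin.forall_fin_two.mpr ⟨h0, h1⟩

theorem exponentPoint_mem_newtonPolyhedron {f : ConvergentSeries} {m : Fin 2 →₀ ℕ}
    (hm : coeff m (f : MvPowerSeries (Fin 2) ℂ) ≠ 0) : exponentPoint m ∈ newtonPolyhedron f :=
  subset_convexHull ℝ _ ⟨m, hm, le_rfl⟩

theorem add_mem_newtonPolyhedron {f : ConvergentSeries} {p q : Fin 2 → ℝ}
    (hp : p ∈ newtonPolyhedron f) (hq : 0 ≤ q) : p + q ∈ newtonPolyhedron f := by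
  suffices h : newtonPolyhedron f ⊆ (· + q) ⁻¹' newtonPolyhedron f from h hp
  refine convexHull_min ?_ ((convex_convexHull ℝ _).translate_preimage_left q)
  rintro x ⟨m, hm, hmx⟩
  exact subset_convexHull ℝ _ ⟨m, hm, hmx.trans (le_add_of_nonneg_right hq)⟩

theorem le_dotProduct_of_mem_newtonPolyhedron {f : ConvergentSeries} {c : Fin 2 → ℝ} {d : ℝ}
    (hc : 0 ≤ c)
    (hd : ∀ m, coeff m (f : MvPowerSeries (Fin 2) ℂ) ≠ 0 → d ≤ c ⬝ᵥ exponentPoint m)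
    {p : Fin 2 → ℝ} (hp : p ∈ newtonPolyhedron f) : d ≤ c ⬝ᵥ p := by
  suffices h : newtonPolyhedron f ⊆ {p | d ≤ c ⬝ᵥ p} from h hp
  refine convexHull_min ?_ (convex_halfSpace_ge (dotProductBilin ℝ ℝ c).isLinear d)
  rintro x ⟨m, hm, hmx⟩
  exact (hd m hm).trans (dotProduct_le_dotProduct_of_nonneg_left hmx hc)

/-- The part of the Newton polyhedron of `f` on which the linear form with coefficients `c` takes
the value `d`; a face if `d` is the minimum of the form. -/
def newtonFace (f : ConvergentSeries) (c : Fin 2 → ℝ) (d : ℝ) : Set (Fin 2 → ℝ) :=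
  {p ∈ newtonPolyhedron f | c ⬝ᵥ p = d}

theorem newtonFace_smul (f : ConvergentSeries) (c : Fin 2 → ℝ) (d : ℝ) {κ : ℝ} (hκ : κ ≠ 0) :
    newtonFace f (κ • c) (κ * d) = newtonFace f c d := by
  ext p
  simp only [newtonFace, Set.mem_ofPred_eq, smul_dotProduct, smul_eq_mul, mul_right_inj' hκ]

theorem newtonFace_eq_convexHull {f : ConvergentSeries} {c : Fin 2 → ℝ} {d : ℝ}
    (hc : ∀ k, 0 < c k)
    (hd : ∀ m, coeff m (f : MvPowerSeries (Fin 2) ℂ) ≠ 0 → d ≤ c ⬝ᵥ exponentPoint m) :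
    newtonFace f c d = convexHull ℝ (exponentPoint ''
      {m | coeff m (f : MvPowerSeries (Fin 2) ℂ) ≠ 0 ∧ c ⬝ᵥ exponentPoint m = d}) := by
  have hc0 : 0 ≤ c := fun k => (hc k).le
  have hface := convexHull_inter_hyperplane (dotProductBilin ℝ ℝ c)
    (S := {p | ∃ m, coeff m (f : MvPowerSeries (Fin 2) ℂ) ≠ 0 ∧ exponentPoint m ≤ p}) (d := d) <| by
      rintro x ⟨m, hm, hmx⟩
      exact (hd m hm).trans (dotProduct_le_dotProduct_of_nonneg_left hmx hc0)
  refine hface.trans (congrArg _ (Set.Subset.antisymm ?_ ?_))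
  · rintro x ⟨⟨m, hm, hmx⟩, hxd : c ⬝ᵥ x = d⟩
    have hmd : c ⬝ᵥ exponentPoint m = d :=
      le_antisymm (hxd ▸ dotProduct_le_dotProduct_of_nonneg_left hmx hc0) (hd m hm)
    refine ⟨m, ⟨hm, hmd⟩, funext fun k => ?_⟩
    have hsum := (Finset.sum_eq_sum_iff_of_le fun k _ =>
      mul_le_mul_of_nonneg_left (hmx k) (hc0 k)).mp (hmd.trans hxd.symm)
    exact mul_left_cancel₀ (hc k).ne' (hsum k (Finset.mem_univ k))
  · rintro _ ⟨m, ⟨hm, hmd⟩, rfl⟩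
    exact ⟨⟨m, hm, le_rfl⟩, hmd⟩

/-- The weight `w` defines a facet of the Newton boundary of `f`, on which it takes the
value `d`. -/
structure IsFacetWeight (f : MvPowerSeries (Fin 2) ℂ) (w : Fin 2 → ℕ) (d : ℕ) : Prop where
  pos : ∀ k, 0 < w k
  coprime : (w 0).Coprime (w 1)
  mem_weightIdeal : f ∈ weightIdeal w d
  exists_ne : ∃ m n : Fin 2 →₀ ℕ, m ≠ n ∧ coeff m f ≠ 0 ∧ coeff n f ≠ 0 ∧
    Finsupp.weight w m = d ∧ Finsupp.weight w n = d

theorem exponentPoint_mem_newtonFace {f : ConvergentSeries} {w : Fin 2 → ℕ} {d : ℕ}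
    {m : Fin 2 →₀ ℕ} (hm : coeff m (f : MvPowerSeries (Fin 2) ℂ) ≠ 0) :
    exponentPoint m ∈ newtonFace f (fun k => w k) d ↔ Finsupp.weight w m = d := by
  rw [newtonFace, Set.mem_ofPred_eq, ← natCast_weight, Nat.cast_inj]
  exact and_iff_right (exponentPoint_mem_newtonPolyhedron hm)

theorem facetJet_newtonFace (f : ConvergentSeries) (w : Fin 2 → ℕ) (d : ℕ) :
    facetJet f (newtonFace f (fun k => w k) d) =
      weightedJet w d (f : MvPowerSeries (Fin 2) ℂ) := by
  classical
  refine finsum_congr fun m => ?_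
  by_cases hm : coeff m (f : MvPowerSeries (Fin 2) ℂ) = 0
  · simp only [hm, map_zero, ite_self]
  · simp only [exponentPoint_mem_newtonFace hm]

theorem IsFacetWeight.isWeightOf {f : ConvergentSeries} {w : Fin 2 → ℕ} {d : ℕ}
    (h : IsFacetWeight (f : MvPowerSeries (Fin 2) ℂ) w d) :
    IsWeightOf w (newtonFace f (fun k => w k) d) := by
  refine ⟨h.pos 0, h.pos 1, h.coprime, fun p hp q hq => ?_⟩
  simpa only [dotProduct, Fin.sum_univ_two] using hp.2.trans hq.2.symm

theorem IsFacetWeight.le_dotProduct {f : ConvergentSeries} {w : Fin 2 → ℕ} {d : ℕ}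
    (h : IsFacetWeight (f : MvPowerSeries (Fin 2) ℂ) w d) (m : Fin 2 →₀ ℕ)
    (hm : coeff m (f : MvPowerSeries (Fin 2) ℂ) ≠ 0) :
    (d : ℝ) ≤ (fun k => (w k : ℝ)) ⬝ᵥ exponentPoint m := by
  rw [← natCast_weight]
  exact Nat.cast_le.mpr (_root_.mem_weightIdeal.mp h.mem_weightIdeal m hm)

theorem isExposed_newtonFace {f : ConvergentSeries} {c : Fin 2 → ℝ} {d : ℝ}
    (hd : ∀ p ∈ newtonPolyhedron f, d ≤ c ⬝ᵥ p) :
    IsExposed ℝ (newtonPolyhedron f) (newtonFace f c d) := by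
  rintro ⟨q, hq⟩
  refine ⟨-LinearMap.toContinuousLinearMap (dotProductBilin ℝ ℝ c), Set.ext fun p => ?_⟩
  refine and_congr_right fun hp => ⟨fun hpd y hy => ?_, fun h => le_antisymm ?_ (hd p hp)⟩
  · exact neg_le_neg (hpd.trans_le (hd y hy))
  · exact (neg_le_neg_iff.mp (h q hq.1)).trans_eq hq.2

theorem IsFacetWeight.isFacet {f : ConvergentSeries} {w : Fin 2 → ℕ} {d : ℕ}
    (h : IsFacetWeight (f : MvPowerSeries (Fin 2) ℂ) w d) :
    IsFacet f (newtonFace f (fun k => w k) d) := by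
  have hc : ∀ k, (0 : ℝ) < w k := fun k => Nat.cast_pos.mpr (h.pos k)
  obtain ⟨m, n, hmn, hm, hn, hmd, hnd⟩ := h.exists_ne
  refine ⟨isExposed_newtonFace fun p hp =>
    le_dotProduct_of_mem_newtonPolyhedron (fun k => (hc k).le) h.le_dotProduct hp, ?_,
    ⟨_, (exponentPoint_mem_newtonFace hm).mpr hmd, _, (exponentPoint_mem_newtonFace hn).mpr hnd,
      exponentPoint_injective.ne hmn⟩⟩
  rw [newtonFace_eq_convexHull hc h.le_dotProduct]
  refine (((finite_setOf_weight_eq h.pos d).subset fun n hn => ?_).image _).isCompact_convexHull ℝ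
  exact Nat.cast_injective ((natCast_weight w n).trans hn.2)

theorem exists_eq_newtonFace_of_isExposed {f : ConvergentSeries} {Δ : Set (Fin 2 → ℝ)}
    (h : IsExposed ℝ (newtonPolyhedron f) Δ) (hne : Δ.Nonempty) :
    ∃ c d, Δ = newtonFace f c d ∧ ∀ p ∈ newtonPolyhedron f, d ≤ c ⬝ᵥ p := by
  obtain ⟨l, rfl⟩ := h hne
  obtain ⟨p, hp, hmax⟩ := hne
  obtain ⟨c, hc⟩ := (dotProductEquiv ℝ (Fin 2)).surjective (-l.toLinearMap)
  have hl : ∀ x, c ⬝ᵥ x = -l x := LinearMap.congr_fun hc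
  refine ⟨c, c ⬝ᵥ p, Set.ext fun q => and_congr_right fun hq => ?_, fun q hq => ?_⟩
  · rw [hl, hl, neg_inj]
    exact ⟨fun h => le_antisymm (hmax q hq) (h p hp), fun h y hy => (hmax y hy).trans_eq h.symm⟩
  · rw [hl, hl]
    exact neg_le_neg (hmax q hq)

theorem pos_of_bddAbove_newtonFace {f : ConvergentSeries} {c : Fin 2 → ℝ} {d : ℝ}
    (hd : ∀ p ∈ newtonPolyhedron f, d ≤ c ⬝ᵥ p) (hne : (newtonFace f c d).Nonempty)
    (hbdd : BddAbove (newtonFace f c d)) (k : Fin 2) : 0 < c k := by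
  obtain ⟨p, hp, hpd⟩ := hne
  have hmem : ∀ t : ℝ, 0 ≤ t → p + Pi.single k t ∈ newtonPolyhedron f := fun t ht =>
    add_mem_newtonPolyhedron hp (Pi.single_nonneg.mpr ht)
  have hval : ∀ t : ℝ, c ⬝ᵥ (p + Pi.single k t) = d + c k * t := fun t => by
    rw [dotProduct_add, dotProduct_single, hpd]
  have hnonneg : 0 ≤ c k := by
    have := hd _ (hmem 1 zero_le_one)
    rwa [hval, mul_one, le_add_iff_nonneg_right] at this
  refine hnonneg.lt_of_ne fun hzero => ?_
  obtain ⟨B, hB⟩ := hbdd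
  have hle : p k + (|B k - p k| + 1) ≤ B k := by
    have := hB ⟨hmem (|B k - p k| + 1) (by positivity), by rw [hval, ← hzero, zero_mul, add_zero]⟩ k
    rwa [Pi.add_apply, Pi.single_eq_same] at this
  linarith [le_abs_self (B k - p k)]

theorem IsFacet.exists_eq_newtonFace {f : ConvergentSeries} {Δ : Set (Fin 2 → ℝ)}
    (h : IsFacet f Δ) : ∃ c d, Δ = newtonFace f c d ∧ (∀ k, 0 < c k) ∧
      (∀ m, coeff m (f : MvPowerSeries (Fin 2) ℂ) ≠ 0 → d ≤ c ⬝ᵥ exponentPoint m) ∧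
      {m | coeff m (f : MvPowerSeries (Fin 2) ℂ) ≠ 0 ∧ c ⬝ᵥ exponentPoint m = d}.Nontrivial := by
  obtain ⟨hexp, hcomp, hnt⟩ := h
  obtain ⟨c, d, rfl, hd⟩ := exists_eq_newtonFace_of_isExposed hexp hnt.nonempty
  have hc := pos_of_bddAbove_newtonFace hd hnt.nonempty hcomp.isBounded.bddAbove
  have hd' : ∀ m, coeff m (f : MvPowerSeries (Fin 2) ℂ) ≠ 0 → d ≤ c ⬝ᵥ exponentPoint m :=
    fun m hm => hd _ (exponentPoint_mem_newtonPolyhedron hm)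
  refine ⟨c, d, rfl, hc, hd', Set.not_subsingleton_iff.mp fun hss => ?_⟩
  rw [newtonFace_eq_convexHull hc hd'] at hnt
  rcases (hss.image exponentPoint).eq_empty_or_singleton with hS | ⟨x, hS⟩
  · simp only [hS, convexHull_empty, Set.not_nontrivial_empty] at hnt
  · simp only [hS, convexHull_singleton, Set.not_nontrivial_singleton] at hnt

theorem IsFacet.exists_isFacetWeight {f : ConvergentSeries} {Δ : Set (Fin 2 → ℝ)}
    (h : IsFacet f Δ) : ∃ (w : Fin 2 → ℕ) (d : ℕ),
      IsFacetWeight (f : MvPowerSeries (Fin 2) ℂ) w d ∧ Δ = newtonFace f (fun k => w k) d := by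
  obtain ⟨c, d, rfl, hc, hd, m, ⟨hm, rfl⟩, n, ⟨hn, hnd⟩, hmn⟩ := h.exists_eq_newtonFace
  obtain ⟨w, hw, hcop, κ, hκ, rfl⟩ := exists_coprime_of_dotProduct_eq hc hmn hnd.symm
  simp only [smul_dotProduct, smul_eq_mul, ← natCast_weight, mul_right_inj' hκ.ne', Nat.cast_inj,
    mul_le_mul_iff_right₀ hκ, Nat.cast_le] at hd hnd ⊢
  exact ⟨w, Finsupp.weight w m, ⟨hw, hcop, mem_weightIdeal.mpr hd, m, n, hmn, hm, hn, rfl, hnd⟩,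
    newtonFace_smul f _ _ hκ.ne'⟩

theorem hasNondegenerateFacets_iff {f : ConvergentSeries} : HasNondegenerateFacets f ↔
    ∀ w d, IsFacetWeight (f : MvPowerSeries (Fin 2) ℂ) w d →
      ∃ h, IsSaturation (weightedJet w d (f : MvPowerSeries (Fin 2) ℂ)) h ∧
        HasFiniteMilnorNumber (ofPoly h) := by
  constructor
  · intro h w d hwd
    rw [← facetJet_newtonFace]
    exact h _ hwd.isFacet
  · intro h Δ hΔ
    obtain ⟨w, d, hwd, rfl⟩ := hΔ.exists_isFacetWeight
    rw [facetJet_newtonFace]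
    exact h w d hwd

end ConvergentSeries

end NewtonBoundary

/-! ### Normalization -/

section WeightedHomogeneous

open MvPolynomial

variable {σ R : Type*} [CommRing R]

theorem X_pow_dvd_iff_forall_le {i : σ} {d : ℕ} {p : MvPolynomial σ R} :
    X i ^ d ∣ p ↔ ∀ m, coeff m p ≠ 0 → d ≤ m i := by
  classical
  refine ⟨?_, fun h => ?_⟩
  · rintro ⟨q, rfl⟩ m hm
    rw [X_pow_eq_monomial, coeff_monomial_mul'] at hm
    exact Finsupp.single_le_iff.mp (by_contra fun hle => hm (if_neg hle))
  · rw [X_pow_eq_monomial, monomial_one_dvd_iff_modMonomial_eq_zero]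
    ext m
    by_cases hle : Finsupp.single i d ≤ m
    · exact coeff_modMonomial_of_le p hle
    · rw [coeff_modMonomial_of_not_le p hle]
      exact by_contra fun hm => hle (Finsupp.single_le_iff.mpr (h m hm))

theorem X_dvd_iff_forall_coeff {i : σ} {p : MvPolynomial σ R} :
    X i ∣ p ↔ ∀ m, coeff m p ≠ 0 → m i ≠ 0 := by
  simpa only [pow_one, Nat.one_le_iff_ne_zero] using X_pow_dvd_iff_forall_le (d := 1) (p := p)

/-- The homogenization homomorphism `x_k ↦ x_k t ^ w_k`, whose `t`-expansion is the decomposition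
of a polynomial into weighted homogeneous components. -/
noncomputable def weightHomogenize (w : σ → ℕ) :
    MvPolynomial σ R →ₐ[R] Polynomial (MvPolynomial σ R) :=
  aeval fun k => Polynomial.C (X k) * Polynomial.X ^ w k

theorem weightHomogenize_monomial (w : σ → ℕ) (m : σ →₀ ℕ) (c : R) :
    weightHomogenize w (monomial m c) =
      Polynomial.monomial (Finsupp.weight w m) (monomial m c) := by
  simp only [weightHomogenize, aeval_monomial, mul_pow, Finsupp.prod_mul, ← map_pow, ← pow_mul,
    Polynomial.algebraMap_apply, algebraMap_eq]
  rw [← map_finsuppProd, ← mul_assoc, ← map_mul, ← monomial_eq, Finsupp.prod,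
    Finset.prod_pow_eq_pow_sum, Polynomial.C_mul_X_pow_eq_monomial,
    Finsupp.weight_apply, Finsupp.sum]
  simp only [smul_eq_mul, mul_comm]

theorem coeff_weightHomogenize (w : σ → ℕ) (p : MvPolynomial σ R) (n : ℕ) :
    (weightHomogenize w p).coeff n = weightedHomogeneousComponent w n p := by
  classical
  induction p using MvPolynomial.induction_on' with
  | monomial m c =>
    rw [weightHomogenize_monomial, Polynomial.coeff_monomial,
      weightedHomogeneousComponent_of_mem (isWeightedHomogeneous_monomial w m c rfl)]
    simp only [eq_comm]
  | add p q hp hq => rw [map_add, Polynomial.coeff_add, hp, hq, map_add]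

theorem weightHomogenize_injective (w : σ → ℕ) :
    Function.Injective (weightHomogenize w : MvPolynomial σ R → _) := fun p q h => by
  rw [← finsum_weightedHomogeneousComponent w p, ← finsum_weightedHomogeneousComponent w q]
  simp only [← coeff_weightHomogenize, h]

theorem weightHomogenize_of_isWeightedHomogeneous {w : σ → ℕ} {p : MvPolynomial σ R} {n : ℕ}
    (hp : IsWeightedHomogeneous w p n) : weightHomogenize w p = Polynomial.monomial n p := by
  ext1 k
  rw [coeff_weightHomogenize, weightedHomogeneousComponent_of_mem hp, Polynomial.coeff_monomial]
  simp only [eq_comm]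

theorem exists_isWeightedHomogeneous_of_dvd [IsDomain R] {w : σ → ℕ} {p q : MvPolynomial σ R}
    {n : ℕ} (hq : IsWeightedHomogeneous w q n) (hq0 : q ≠ 0) (hpq : p ∣ q) :
    ∃ a, IsWeightedHomogeneous w p a := by
  obtain ⟨r, rfl⟩ := hpq
  have hne {s : MvPolynomial σ R} (hs : s ≠ 0) : weightHomogenize w s ≠ 0 :=
    (map_ne_zero_iff _ (weightHomogenize_injective w)).mpr hs
  have hp := hne (left_ne_zero_of_mul hq0)
  have hr := hne (right_ne_zero_of_mul hq0)
  have hmul := weightHomogenize_of_isWeightedHomogeneous hq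
  rw [map_mul] at hmul
  have hdeg := congrArg Polynomial.natDegree hmul
  have htdeg := congrArg Polynomial.natTrailingDegree hmul
  rw [Polynomial.natDegree_mul hp hr, Polynomial.natDegree_monomial_eq n hq0] at hdeg
  rw [Polynomial.natTrailingDegree_mul hp hr, Polynomial.natTrailingDegree_monomial hq0] at htdeg
  have hp_le := (weightHomogenize w p).natTrailingDegree_le_natDegree
  have hr_le := (weightHomogenize w r).natTrailingDegree_le_natDegree
  refine ⟨(weightHomogenize w p).natDegree, fun {m} hm => ?_⟩
  have hcoeff : (weightHomogenize w p).coeff (Finsupp.weight w m) ≠ 0 := fun h => hm <| by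
    classical
    rw [← coeff_zero m, ← h, coeff_weightHomogenize, coeff_weightedHomogeneousComponent, if_pos rfl]
  have h_le := Polynomial.le_natDegree_of_ne_zero hcoeff
  have h_ge := Polynomial.natTrailingDegree_le_of_ne_zero hcoeff
  lia

end WeightedHomogeneous

theorem pairwise_not_associated_of_squarefree {M : Type*} [CommMonoid M] {L : List M}
    (h : Squarefree L.prod) (hL : ∀ p ∈ L, ¬ IsUnit p) :
    L.Pairwise fun p q => ¬ Associated p q := by
  induction L with
  | nil => exact List.Pairwise.nil
  | cons a L ih =>
    rw [List.prod_cons] at h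
    obtain ⟨ha, hL⟩ := List.forall_mem_cons.mp hL
    refine List.pairwise_cons.mpr ⟨fun b hb hab => ha (h a ?_), ih (h.of_mul_right) hL⟩
    exact mul_dvd_mul_left a (hab.dvd.trans (List.dvd_prod hb))

section TwoVariables

open MvPolynomial

variable {K : Type*} [Field K] {w : Fin 2 → ℕ} {p : MvPolynomial (Fin 2) K} {n : ℕ} {i j : Fin 2}

theorem isUnit_of_isWeightedHomogeneous_zero {σ : Type*} {w : σ → ℕ} (hw : ∀ k, 0 < w k)
    {p : MvPolynomial σ K} (hp : IsWeightedHomogeneous w p 0) (hp0 : p ≠ 0) : IsUnit p := by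
  rw [← hp.weightedHomogeneousComponent_same,
    weightedHomogeneousComponent_zero p fun k => (hw k).ne'] at hp0 ⊢
  exact (isUnit_iff_ne_zero.mpr fun h => hp0 (by rw [h, C_0])).map C

theorem exists_pos_coeff_single_ne_zero (hw : ∀ k, 0 < w k) (hp : IsWeightedHomogeneous w p n)
    (hu : ¬ IsUnit p) (hij : i ≠ j) (hj : ¬ X j ∣ p) :
    ∃ k, 0 < k ∧ coeff (Finsupp.single i k) p ≠ 0 := by
  rw [X_dvd_iff_forall_coeff] at hj
  push Not at hj
  obtain ⟨m, hm, hmj⟩ := hj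
  obtain ⟨k, rfl⟩ : ∃ k, m = Finsupp.single i k :=
    ⟨m i, finsupp_ext_fin_two hij (by simp) (by simp [hmj, hij.symm])⟩
  refine ⟨k, Nat.pos_of_ne_zero fun hk => hu ?_, hm⟩
  rw [hk, Finsupp.single_zero] at hm
  obtain rfl : 0 = n := by rw [← hp hm, map_zero]
  exact isUnit_of_isWeightedHomogeneous_zero hw hp fun hp0 => hm (by rw [hp0, coeff_zero])

theorem coeff_aeval_update_one (hwj : 0 < w j) (hp : IsWeightedHomogeneous w p n) (hij : i ≠ j)
    {m : Fin 2 →₀ ℕ} (hm : Finsupp.weight w m = n) :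
    (aeval (Function.update (1 : Fin 2 → Polynomial K) i Polynomial.X) p).coeff (m i) =
      coeff m p := by
  classical
  induction hp using IsWeightedHomogeneous.induction_on with
  | zero => simp
  | add p q _ _ hp hq => rw [map_add, Polynomial.coeff_add, hp, hq, coeff_add]
  | monomial k c hk =>
    have hkm : m i = k i ↔ k = m := ⟨fun h => finsupp_ext_fin_two hij h.symm ?_, fun h => h ▸ rfl⟩
    · rw [aeval_monomial, Finsupp.prod_fintype _ _ fun _ => pow_zero _,
        Finset.prod_eq_single_of_mem i (Finset.mem_univ i)
          fun k _ hk => by rw [Function.update_of_ne hk, Pi.one_apply, one_pow],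
        Function.update_self, Polynomial.algebraMap_eq, Polynomial.coeff_C_mul_X_pow,
        coeff_monomial]
      simp only [hkm]
    · rw [← hm, weight_fin_two w k hij, weight_fin_two w m hij, h, Nat.add_left_cancel_iff] at hk
      exact Nat.eq_of_mul_eq_mul_left hwj hk

theorem exists_eval_update_one_eq_zero [IsAlgClosed K] (hw : ∀ k, 0 < w k)
    (hp : IsWeightedHomogeneous w p n) (hu : ¬ IsUnit p) (hij : i ≠ j) (hj : ¬ X j ∣ p) :
    ∃ c, eval (Function.update 1 i c) p = 0 := by
  obtain ⟨k, hk, hcoeff⟩ := exists_pos_coeff_single_ne_zero hw hp hu hij hj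
  set q := aeval (Function.update (1 : Fin 2 → Polynomial K) i Polynomial.X) p with hq
  have hqk : q.coeff k ≠ 0 := by
    rwa [← coeff_aeval_update_one (hw j) hp hij (hp hcoeff), Finsupp.single_eq_same] at hcoeff
  have hdeg : q.degree ≠ 0 := fun h => hk.not_ge <|
    (Polynomial.le_natDegree_of_ne_zero hqk).trans_eq (Polynomial.natDegree_eq_of_degree_eq_some h)
  obtain ⟨c, hc⟩ := IsAlgClosed.exists_root q hdeg
  refine ⟨c, ?_⟩
  rw [← hc.eq_zero, hq, ← Polynomial.coe_aeval_eq_eval, ← AlgHom.comp_apply, comp_aeval,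
    ← aeval_eq_eval]
  congr 2 with s
  rcases eq_or_ne s i with rfl | hs
  · simp
  · simp [hs]

theorem exists_ne_zero_eval_eq_zero [IsAlgClosed K] (hw : ∀ k, 0 < w k)
    (hp : IsWeightedHomogeneous w p n) (hu : ¬ IsUnit p) : ∃ P ≠ 0, eval P p = 0 := by
  by_cases hX : X 1 ∣ p
  · obtain ⟨q, rfl⟩ := hX
    exact ⟨Pi.single 0 1, Pi.single_ne_zero_iff.mpr one_ne_zero, by simp⟩
  · obtain ⟨c, hc⟩ := exists_eval_update_one_eq_zero hw hp hu zero_ne_one hX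
    exact ⟨_, fun h => one_ne_zero (congrFun h 1), hc⟩

theorem weight_eq_one_of_degreeOf_eq_one (hw : ∀ k, 0 < w k) (hp : IsWeightedHomogeneous w p n)
    (hu : ¬ IsUnit p) (hij : i ≠ j) (hcop : (w i).Coprime (w j)) (hi : ¬ X i ∣ p)
    (hj : ¬ X j ∣ p) (hdeg : degreeOf i p = 1) : w j = 1 := by
  obtain ⟨a, ha, hpa⟩ := exists_pos_coeff_single_ne_zero hw hp hu hij hj
  obtain ⟨b, -, hpb⟩ := exists_pos_coeff_single_ne_zero hw hp hu hij.symm hi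
  have ha_le := monomial_le_degreeOf i (mem_support_iff.mpr hpa)
  rw [Finsupp.single_eq_same, hdeg] at ha_le
  obtain rfl : a = 1 := le_antisymm ha_le ha
  have hab := (hp hpa).trans (hp hpb).symm
  rw [Finsupp.weight_single, Finsupp.weight_single, one_smul, smul_eq_mul] at hab
  exact Nat.eq_one_of_dvd_coprimes hcop ⟨b, hab.trans (mul_comm _ _)⟩ dvd_rfl

end TwoVariables

namespace ConvergentSeries

open MvPolynomial

theorem not_isUnit_of_hasFiniteMilnorNumber {p : MvPolynomial (Fin 2) ℂ}
    (hM : HasFiniteMilnorNumber (ofPoly p)) : ¬ IsUnit p := fun hu => by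
  obtain ⟨c, -, rfl⟩ := isUnit_iff_eq_C_of_isReduced.mp hu
  exact one_ne_zero <| eq_zero_of_forall_eval_pderiv_eq_zero (w := 1) (fun _ => one_pos)
    (isWeightedHomogeneous_C _ c) hM (P := 1) fun k => by rw [pderiv_C, map_zero]

theorem squarefree_of_hasFiniteMilnorNumber {w : Fin 2 → ℕ} (hw : ∀ k, 0 < w k)
    {p : MvPolynomial (Fin 2) ℂ} (hp0 : p ≠ 0) {n : ℕ} (hp : IsWeightedHomogeneous w p n)
    (hM : HasFiniteMilnorNumber (ofPoly p)) : Squarefree p := by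
  refine (squarefree_iff_no_irreducibles hp0).mpr fun q hq hqq => ?_
  obtain ⟨a, ha⟩ := exists_isWeightedHomogeneous_of_dvd hp hp0 (dvd_of_mul_left_dvd hqq)
  obtain ⟨P, hP, hPq⟩ := exists_ne_zero_eval_eq_zero hw ha hq.not_isUnit
  obtain ⟨r, rfl⟩ := hqq
  refine hP (eq_zero_of_forall_eval_pderiv_eq_zero hw hp hM fun k => ?_)
  simp only [pderiv_mul, map_add, map_mul, hPq, zero_mul, mul_zero, add_zero]

theorem exists_isFactorization {w : Fin 2 → ℕ} {k l n : ℕ} {p : MvPolynomial (Fin 2) ℂ}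
    (hp : IsWeightedHomogeneous w p n) (hu : ¬ IsUnit p) (hsq : Squarefree p) (h0 : ¬ X 0 ∣ p)
    (h1 : ¬ X 1 ∣ p) : ∃ gs hs, IsFactorization w (X 0 ^ k * X 1 ^ l * p) k l gs hs := by
  classical
  have hp0 : p ≠ 0 := hsq.ne_zero
  obtain ⟨S, hirr, hprod, -⟩ := (WfDvdMonoid.not_isUnit_iff_exists_factors_eq p hp0).mp hu
  have hdvd (q) (hq : q ∈ S) : q ∣ p := hprod ▸ Multiset.dvd_prod hq
  have hhom (q) (hq : q ∈ S) : IsHomogeneousNonunit w q :=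
    ⟨(hirr q hq).not_isUnit, exists_isWeightedHomogeneous_of_dvd hp hp0 (hdvd q hq)⟩
  have hlist : (S.filter IsLinearInOneVariable).toList.prod *
      (S.filter fun q => ¬ IsLinearInOneVariable q).toList.prod = p := by
    rw [Multiset.prod_toList, Multiset.prod_toList, Multiset.prod_filter_mul_prod_filter_not, hprod]
  refine ⟨(S.filter IsLinearInOneVariable).toList,
    (S.filter fun q => ¬ IsLinearInOneVariable q).toList, ?_, ?_, ?_, ?_⟩
  · rw [mul_assoc _ (List.prod _), hlist]
  · simp only [Multiset.mem_toList, Multiset.mem_filter]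
    exact fun q hq => ⟨hirr q hq.1, hhom q hq.1, hq.2,
      fun ha => h0 (ha.symm.dvd.trans (hdvd q hq.1)),
      fun ha => h1 (ha.symm.dvd.trans (hdvd q hq.1))⟩
  · simp only [Multiset.mem_toList, Multiset.mem_filter]
    exact fun q hq => ⟨hirr q hq.1, hhom q hq.1, hq.2⟩
  · refine pairwise_not_associated_of_squarefree
      (hsq.squarefree_of_dvd (Dvd.intro_left _ hlist)) fun q hq => ?_
    rw [Multiset.mem_toList, Multiset.mem_filter] at hq
    exact (hirr q hq.1).not_isUnit

theorem weight_eq_one_of_isLinearInOneVariable {w : Fin 2 → ℕ} (hw : ∀ k, 0 < w k)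
    (hcop : (w 0).Coprime (w 1)) {p : MvPolynomial (Fin 2) ℂ} (hirr : Irreducible p)
    (hp : IsHomogeneousNonunit w p) (hlin : IsLinearInOneVariable p)
    (h0 : ¬ Associated p (X 0)) (h1 : ¬ Associated p (X 1)) : w 0 = 1 ∨ w 1 = 1 := by
  obtain ⟨hu, n, hn⟩ := hp
  have hndvd {i : Fin 2} (hi : ¬ Associated p (X i)) : ¬ X i ∣ p := fun hX =>
    hi (((X_prime).irreducible.dvd_irreducible_iff_associated hirr).mp hX).symm
  rcases hlin with hdeg | hdeg
  · exact .inr (weight_eq_one_of_degreeOf_eq_one hw hn hu zero_ne_one hcop (hndvd h0) (hndvd h1)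
      hdeg)
  · exact .inl (weight_eq_one_of_degreeOf_eq_one hw hn hu one_ne_zero hcop.symm (hndvd h1)
      (hndvd h0) hdeg)

theorem IsFacetWeight.weightedJet_ne_zero {f : MvPowerSeries (Fin 2) ℂ} {w : Fin 2 → ℕ} {d : ℕ}
    (h : IsFacetWeight f w d) : weightedJet w d f ≠ 0 := fun h0 => by
  obtain ⟨m, -, -, hm, -, hmd, -⟩ := h.exists_ne
  have hcoeff := coeff_weightedJet h.pos d f m
  rw [h0, coeff_zero, if_pos hmd] at hcoeff
  exact hm hcoeff.symm

/-- `f` has a facet whose jet contains a term free of `X i` and whose weight is one on the other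
variable `X j`. Such a facet comes from smooth branches `X i = φ (X j)`. -/
def HasSmoothFacetAt (f : MvPowerSeries (Fin 2) ℂ) (i : Fin 2) : Prop :=
  ∃ w d, IsFacetWeight f w d ∧ (∀ j ≠ i, w j = 1) ∧ ¬ X i ∣ weightedJet w d f

theorem not_X_dvd_X_pow_mul {i j : Fin 2} (hij : i ≠ j) {p : MvPolynomial (Fin 2) ℂ}
    (hp : ¬ X i ∣ p) (l : ℕ) : ¬ X i ∣ X j ^ l * p := by
  rw [X_prime.dvd_mul, not_or]
  exact ⟨fun h => hij (X_dvd_X.mp (X_prime.dvd_of_dvd_pow h)), hp⟩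

theorem isNormalizedAt_of_not_hasSmoothFacetAt {f : ConvergentSeries}
    (hnd : HasNondegenerateFacets f)
    (hs : ∀ i, ¬ HasSmoothFacetAt (f : MvPowerSeries (Fin 2) ℂ) i) {Δ : Set (Fin 2 → ℝ)}
    (hΔ : IsFacet f Δ) : IsNormalizedAt f Δ := by
  obtain ⟨w, d, hwd, rfl⟩ := hΔ.exists_isFacetWeight
  obtain ⟨h, ⟨⟨k, l, hkl⟩, hX0, hX1⟩, hM⟩ := hasNondegenerateFacets_iff.mp hnd w d hwd
  have hjet : weightedJet w d (f : MvPowerSeries (Fin 2) ℂ) ≠ 0 := hwd.weightedJet_ne_zero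
  have hdvd : h ∣ weightedJet w d (f : MvPowerSeries (Fin 2) ℂ) := Dvd.intro_left _ hkl.symm
  have h0 : h ≠ 0 := ne_zero_of_dvd_ne_zero hjet hdvd
  obtain ⟨n, hn⟩ := exists_isWeightedHomogeneous_of_dvd
    (isWeightedHomogeneous_weightedJet hwd.pos d _) hjet hdvd
  obtain ⟨gs, hs', hfac⟩ := exists_isFactorization (k := k) (l := l) hn
    (not_isUnit_of_hasFiniteMilnorNumber hM) (squarefree_of_hasFiniteMilnorNumber hwd.pos h0 hn hM)
    hX0 hX1
  have hk (hk0 : k = 0) : w 1 ≠ 1 := fun hw1 => hs 0 ⟨w, d, hwd, by simpa [Fin.forall_fin_two], by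
    rw [hkl, hk0, pow_zero, one_mul]
    exact not_X_dvd_X_pow_mul zero_ne_one hX0 l⟩
  have hl (hl0 : l = 0) : w 0 ≠ 1 := fun hw0 => hs 1 ⟨w, d, hwd, by simpa [Fin.forall_fin_two], by
    rw [hkl, hl0, pow_zero, mul_one]
    exact not_X_dvd_X_pow_mul one_ne_zero hX1 k⟩
  have hgs (hlen : gs.length ≠ 0) : w 0 = 1 ∨ w 1 = 1 := by
    obtain ⟨p, hp⟩ := List.exists_mem_of_length_pos (Nat.pos_of_ne_zero hlen)
    obtain ⟨hirr, hhom, hlin, ha0, ha1⟩ := hfac.2.1 p hp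
    exact weight_eq_one_of_isLinearInOneVariable hwd.pos hwd.coprime hirr hhom hlin ha0 ha1
  have hpos := hwd.pos
  refine ⟨w, hwd.isWeightOf, k, l, gs, hs', by rwa [facetJet_newtonFace, hkl], fun heq => ?_,
    fun hlt hk0 => by_contra fun hlen => ?_, fun hlt hl0 => by_contra fun hlen => ?_⟩
  · have hw0 : w 0 = 1 := by simpa [← heq] using hwd.coprime
    exact ⟨fun hk0 => hk hk0 (heq ▸ hw0), fun hl0 => hl hl0 hw0⟩
  · exact (hgs hlen).elim (fun _ => by have := hpos 1; lia) (hk hk0)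
  · exact (hgs hlen).elim (hl hl0) (fun _ => by have := hpos 0; lia)

end ConvergentSeries

/-! ### Straightening smooth branches -/

section SmoothBranches

open MvPowerSeries

section Straightening

variable {σ R : Type*} [CommRing R] {i j : σ} {w : σ → ℕ} {d : ℕ}

theorem X_pow_dvd_iff_mem_weightIdeal [DecidableEq σ] {f : MvPowerSeries σ R} :
    X j ^ d ∣ f ↔ f ∈ weightIdeal (Pi.single j 1) d := by
  simp only [X_pow_dvd_iff, mem_weightIdeal, Finsupp.weight_single_one_apply,
    ← not_lt, not_imp_not]

theorem mem_weightIdeal_of_X_pow_dvd {f : MvPowerSeries σ R} (h : X j ^ d ∣ f) (w : σ → ℕ) :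
    f ∈ weightIdeal w (d * w j) :=
  Ideal.mem_of_dvd _ h (pow_mem_weightIdeal (X_mem_weightIdeal w j) d)

theorem isWeightedHomogeneous_aeval {τ : Type*} {v : τ → ℕ} {s : τ → MvPolynomial σ R}
    (hs : ∀ k, MvPolynomial.IsWeightedHomogeneous w (s k) (v k)) {p : MvPolynomial τ R} {n : ℕ}
    (hp : MvPolynomial.IsWeightedHomogeneous v p n) :
    MvPolynomial.IsWeightedHomogeneous w (MvPolynomial.aeval s p) n := by
  rw [MvPolynomial.aeval_def, MvPolynomial.eval₂_eq]
  refine MvPolynomial.IsWeightedHomogeneous.sum _ _ _ fun m hm => ?_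
  rw [← hp (MvPolynomial.mem_support_iff.mp hm), Finsupp.weight_apply, Finsupp.sum]
  exact (MvPolynomial.IsWeightedHomogeneous.prod _ _ _ fun k _ => (hs k).pow (m k)).C_mul _

theorem coe_mem_weightIdeal {p : MvPolynomial σ R}
    (hp : MvPolynomial.IsWeightedHomogeneous w p d) :
    (p : MvPowerSeries σ R) ∈ weightIdeal w d :=
  mem_weightIdeal.mpr fun m hm => (hp (by rwa [MvPolynomial.coeff_coe] at hm)).ge

theorem X_dvd_weightedJet [Finite σ] (hw : ∀ k, 0 < w k) {f : MvPowerSeries σ R} (h : X i ∣ f) :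
    MvPolynomial.X i ∣ weightedJet w d f := by
  refine X_dvd_iff_forall_coeff.mpr fun m hm hmi => hm ?_
  rw [coeff_weightedJet hw, X_dvd_iff.mp h m hmi, ite_self]

theorem exists_subst_pow_mul_eq [Finite σ] (hw : ∀ k, 0 < w k) {s : σ → MvPolynomial σ R}
    (hs : HasSubst fun k => X j ^ w k * (s k : MvPowerSeries σ R)) {f : MvPowerSeries σ R}
    (hf : f ∈ weightIdeal w d) :
    ∃ G, subst (fun k => X j ^ w k * (s k : MvPowerSeries σ R)) f = X j ^ d * G ∧
      X j ∣ G - (MvPolynomial.aeval s (weightedJet w d f) : MvPowerSeries σ R) := by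
  classical
  have hsw (k) : X j ^ w k * (s k : MvPowerSeries σ R) ∈ weightIdeal (Pi.single j 1) (w k) :=
    X_pow_dvd_iff_mem_weightIdeal.mp (Dvd.intro _ rfl)
  have hjet := X_pow_dvd_iff_mem_weightIdeal.mpr
    (subst_sub_subst_weightedJet_mem hw hs hs hsw hsw (fun k => by simp) hf)
  rw [subst_coe, aeval_pow_mul_of_isWeightedHomogeneous (isWeightedHomogeneous_weightedJet hw d f)
    (fun k => (s k : MvPowerSeries σ R)), ← coe_aeval_eq_aeval_coe] at hjet
  obtain ⟨q, hq⟩ := hjet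
  refine ⟨(MvPolynomial.aeval s (weightedJet w d f) : MvPowerSeries σ R) + X j * q, ?_, ?_⟩
  · rw [eq_add_of_sub_eq hq]
    ring
  · rw [add_sub_cancel_left]
    exact dvd_mul_right _ _

theorem eval_aeval {τ : Type*} (s : τ → MvPolynomial σ R) (Q : σ → R) (p : MvPolynomial τ R) :
    MvPolynomial.eval Q (MvPolynomial.aeval s p) =
      MvPolynomial.eval (fun k => MvPolynomial.eval Q (s k)) p := by
  simp only [← MvPolynomial.aeval_eq_eval, MvPolynomial.comp_aeval_apply]

variable [DecidableEq σ]

theorem X_dvd_of_subst_update_zero [Finite σ] {f : MvPowerSeries σ R}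
    (h : subst (Function.update X i (0 : MvPowerSeries σ R)) f = 0) : X i ∣ f := by
  have hX (k) : (X k : MvPowerSeries σ R) - Function.update X i 0 k ∈
      weightIdeal (Pi.single i 1) (0 + 1) := by
    rcases eq_or_ne k i with rfl | hk
    · simpa using X_mem_weightIdeal (R := R) (Pi.single k 1) k
    · simp [hk]
  have hsub : subst X f - subst (Function.update X i (0 : MvPowerSeries σ R)) f ∈
      weightIdeal (Pi.single i 1) 1 := by
    refine subst_sub_subst_mem_weightIdeal HasSubst.X (hasSubst_update_X (map_zero _)) fun m => ?_
    rw [← smul_sub]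
    refine Submodule.smul_of_tower_mem _ _ ?_
    exact weightIdeal_anti _ (Nat.le_add_left 1 _) (finsuppProd_sub_finsuppProd_mem_weightIdeal
      (v := 0) (fun _ => by simp [weightIdeal_zero]) (fun _ => by simp [weightIdeal_zero]) hX m)
  rw [h, sub_zero, subst_self, id] at hsub
  simpa using X_pow_dvd_iff_mem_weightIdeal.mpr hsub

theorem X_dvd_subst_shear [Finite σ] {f φ : MvPowerSeries σ R} (hφ0 : constantCoeff φ = 0)
    (hφ : φ ∈ varFree R i) (h : subst (Function.update X i φ) f = 0) :
    X i ∣ subst (shear i φ) f := by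
  refine X_dvd_of_subst_update_zero ?_
  have hz : HasSubst (Function.update X i (0 : MvPowerSeries σ R)) :=
    hasSubst_update_X (map_zero _)
  rw [subst_comp_subst_apply (hasSubst_shear hφ0) hz]
  refine Eq.trans (congrArg (subst · f) (funext fun k => ?_)) h
  rcases eq_or_ne k i with rfl | hk
  · rw [shear_self, subst_add hz, subst_X hz, Function.update_self, Function.update_self, zero_add,
      subst_congr_of_mem_varFree hz HasSubst.X (fun l hl => Function.update_of_ne hl ..) hφ,
      subst_self, id]
  · rw [shear_of_ne hk, subst_X hz, Function.update_of_ne hk, Function.update_of_ne hk]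

theorem X_dvd_subst_shear_of_ne [Finite σ] {f φ : MvPowerSeries σ R} (hφ0 : constantCoeff φ = 0)
    (hj : j ≠ i) (h : X j ∣ f) : X j ∣ subst (shear i φ) f := by
  obtain ⟨q, rfl⟩ := h
  have hs := hasSubst_shear (i := i) hφ0
  rw [subst_mul hs, subst_X hs, shear_of_ne hj]
  exact Dvd.intro _ rfl

theorem shear_mem_weightIdeal {φ : MvPowerSeries σ R} (hφ : φ ∈ weightIdeal w (w i)) (k : σ) :
    shear i φ k ∈ weightIdeal w (w k) := by
  rcases eq_or_ne k i with rfl | hk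
  · rw [shear_self]
    exact add_mem (X_mem_weightIdeal w k) hφ
  · rw [shear_of_ne hk]
    exact X_mem_weightIdeal w k

theorem isWeightedHomogeneous_polyShear {p : MvPolynomial σ R}
    (hp : MvPolynomial.IsWeightedHomogeneous w p (w i)) (k : σ) :
    MvPolynomial.IsWeightedHomogeneous w (polyShear i p k) (w k) := by
  rcases eq_or_ne k i with rfl | hk
  · rw [polyShear_self]
    exact (MvPolynomial.isWeightedHomogeneous_X R w k).add hp
  · rw [polyShear_of_ne hk]
    exact MvPolynomial.isWeightedHomogeneous_X R w k

theorem aeval_polyShear_aeval_polyShear [Finite σ] {p q : MvPolynomial σ R}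
    (hp0 : constantCoeff (p : MvPowerSeries σ R) = 0) (hp : (p : MvPowerSeries σ R) ∈ varFree R i)
    (hpq : p + q = 0) (f : MvPolynomial σ R) :
    MvPolynomial.aeval (polyShear i q) (MvPolynomial.aeval (polyShear i p) f) = f := by
  refine MvPolynomial.coe_injective σ R ?_
  rw [coe_aeval_polyShear, coe_aeval_polyShear,
    subst_shear_subst_shear hp0 hp (by rw [← MvPolynomial.coe_add, hpq, MvPolynomial.coe_zero])]

theorem weightedJet_subst_shear [Finite σ] (hw : ∀ k, 0 < w k) {f φ : MvPowerSeries σ R}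
    {p : MvPolynomial σ R} (hφ0 : constantCoeff φ = 0)
    (hp : MvPolynomial.IsWeightedHomogeneous w p (w i))
    (hφp : φ - (p : MvPowerSeries σ R) ∈ weightIdeal w (w i + 1)) (hf : f ∈ weightIdeal w d) :
    weightedJet w d (subst (shear i φ) f) =
      MvPolynomial.aeval (polyShear i p) (weightedJet w d f) := by
  have hpw := coe_mem_weightIdeal hp
  have hφw : φ ∈ weightIdeal w (w i) :=
    (Submodule.sub_mem_iff_left _ hpw).mp (weightIdeal_anti w (w i).le_succ hφp)
  have hp0 : constantCoeff (p : MvPowerSeries σ R) = 0 := by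
    rw [← coeff_zero_eq_constantCoeff_apply]
    exact coeff_eq_zero_of_mem_weightIdeal hpw (by simpa using hw i)
  have hsub (k) : shear i φ k - shear i (p : MvPowerSeries σ R) k ∈ weightIdeal w (w k + 1) := by
    rcases eq_or_ne k i with rfl | hk
    · rwa [shear_self, shear_self, add_sub_add_left_eq_sub]
    · rw [shear_of_ne hk, shear_of_ne hk, sub_self]
      exact zero_mem _
  rw [weightedJet_eq_of_sub_mem hw (subst_sub_subst_weightedJet_mem hw (hasSubst_shear hφ0)
    (hasSubst_shear hp0) (shear_mem_weightIdeal hφw) (shear_mem_weightIdeal hpw) hsub hf),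
    ← coe_aeval_polyShear]
  exact weightedJet_coe hw (isWeightedHomogeneous_aeval (isWeightedHomogeneous_polyShear hp)
    (isWeightedHomogeneous_weightedJet hw d f))

theorem weightedJet_subst_shear_of_mem [Finite σ] (hw : ∀ k, 0 < w k) {f φ : MvPowerSeries σ R}
    (hφ0 : constantCoeff φ = 0) (hφ : φ ∈ weightIdeal w (w i + 1)) (hf : f ∈ weightIdeal w d) :
    weightedJet w d (subst (shear i φ) f) = weightedJet w d f := by
  have hX : polyShear i (0 : MvPolynomial σ R) = MvPolynomial.X := by
    rw [polyShear, add_zero, Function.update_eq_self]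
  rw [weightedJet_subst_shear hw hφ0 (MvPolynomial.isWeightedHomogeneous_zero R w _)
    (by rwa [MvPolynomial.coe_zero, sub_zero]) hf, hX, MvPolynomial.aeval_X_left_apply]

theorem not_X_sq_dvd_aeval_polyShear [Finite σ] {p f : MvPolynomial σ R} {Q : σ → R}
    (hp : MvPolynomial.pderiv i p = 0) (hQ : Q i = 0)
    (hf : MvPolynomial.eval (fun k => MvPolynomial.eval Q (polyShear i p k))
      (MvPolynomial.pderiv i f) ≠ 0) :
    ¬ MvPolynomial.X i ^ 2 ∣ MvPolynomial.aeval (polyShear i p) f := by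
  rintro ⟨q, hq⟩
  have hderiv := congrArg (MvPolynomial.eval Q ∘ MvPolynomial.pderiv i) hq
  simp only [Function.comp_apply, pderiv_aeval_polyShear, hp, mul_zero, add_zero,
    Derivation.leibniz, Derivation.leibniz_pow, map_add, map_mul, smul_eq_mul, map_pow,
    MvPolynomial.eval_X, hQ, nsmul_eq_mul, eval_aeval] at hderiv
  refine hf ?_
  simpa using hderiv

theorem eval_polyShear_update_zero {p : MvPolynomial σ R} {c : R}
    (hc : MvPolynomial.eval (Function.update 1 i 0) p = c) :
    (fun k => MvPolynomial.eval (Function.update 1 i 0) (polyShear i p k)) =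
      Function.update (1 : σ → R) i c := by
  funext k
  rcases eq_or_ne k i with rfl | hk
  · simp [polyShear_self, hc]
  · simp [polyShear_of_ne hk, hk]

theorem constantCoeff_aeval_update_one (c : R) (p : MvPolynomial σ R) :
    MvPolynomial.constantCoeff (MvPolynomial.aeval
      (Function.update 1 i (MvPolynomial.C c + MvPolynomial.X i)) p) =
      MvPolynomial.eval (Function.update 1 i c) p := by
  rw [← MvPolynomial.eval_zero, eval_aeval]
  congr 2
  funext k
  rcases eq_or_ne k i with rfl | hk
  · simp
  · simp [hk]

theorem coeff_single_aeval_update_one [Finite σ] (c : R) (p : MvPolynomial σ R) :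
    MvPolynomial.coeff (Finsupp.single i 1) (MvPolynomial.aeval
      (Function.update 1 i (MvPolynomial.C c + MvPolynomial.X i)) p) =
      MvPolynomial.eval (Function.update 1 i c) (MvPolynomial.pderiv i p) := by
  have := Fintype.ofFinite σ
  set s : σ → MvPolynomial σ R := Function.update 1 i (MvPolynomial.C c + MvPolynomial.X i)
    with hs
  have hderiv (k) : MvPolynomial.pderiv i (s k) = if k = i then 1 else 0 := by
    split_ifs with hk
    · simp [hs, hk]
    · simp [hs, hk]
  have hcoeff := MvPolynomial.coeff_pderiv (i := i) (MvPolynomial.aeval s p) 0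
  rw [derivation_aeval] at hcoeff
  simpa [hderiv, ← constantCoeff_aeval_update_one, MvPolynomial.constantCoeff_eq]
    using hcoeff.symm

end Straightening

theorem coeff_eq_of_X_dvd_sub {σ R : Type*} [CommRing R] {j : σ} {f g : MvPowerSeries σ R}
    (h : X j ∣ f - g) {m : σ →₀ ℕ} (hm : m j = 0) : coeff m f = coeff m g :=
  sub_eq_zero.mp ((map_sub (coeff m) f g).symm.trans (X_dvd_iff.mp h m hm))

theorem X_dvd_of_mem_varFree {R : Type*} [CommRing R] {i j : Fin 2} (hij : i ≠ j)
    {u : MvPowerSeries (Fin 2) R} (hu : u ∈ varFree R i) (hu0 : constantCoeff u = 0) :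
    X j ∣ u := by
  refine X_dvd_iff.mpr fun m hmj => by_contra fun hm => hm ?_
  obtain rfl : m = 0 := finsupp_ext_fin_two hij (mem_varFree.mp hu m hm) hmj
  rwa [coeff_zero_eq_constantCoeff_apply]

namespace ConvergentSeries

theorem isConvergent_of_X_pow_mul {j : Fin 2} {d : ℕ} {f : MvPowerSeries (Fin 2) ℂ}
    (h : IsConvergent (X j ^ d * f)) : IsConvergent f := by
  obtain ⟨r, hr, hs⟩ := h
  refine ⟨r, hr, ((hs.comp_injective (add_right_injective (Finsupp.single j d))).mul_left
    (r ^ d)⁻¹).congr fun m => ?_⟩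
  rw [Function.comp_apply, X_pow_eq, coeff_add_monomial_mul, one_mul, map_add,
    Finsupp.degree_single, pow_add]
  field_simp

/-- Substituting `X i = X j ^ w i * (c + X i)` and dividing by `X j ^ d` turns a simple zero `c` of
the jet into a hypothesis of the implicit function theorem. -/
theorem exists_smooth_branch {i j : Fin 2} (hij : i ≠ j) {f : MvPowerSeries (Fin 2) ℂ}
    (hf : IsConvergent f) {w : Fin 2 → ℕ} (hw : ∀ k, 0 < w k) (hwj : w j = 1) {d : ℕ}
    (hfd : f ∈ weightIdeal w d) {c : ℂ}
    (hc : MvPolynomial.eval (Function.update 1 i c) (weightedJet w d f) = 0)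
    (hc' : MvPolynomial.eval (Function.update 1 i c)
      (MvPolynomial.pderiv i (weightedJet w d f)) ≠ 0) :
    ∃ u : MvPowerSeries (Fin 2) ℂ, IsConvergent u ∧ constantCoeff u = 0 ∧ u ∈ varFree ℂ i ∧
      subst (Function.update X i (X j ^ w i * (C c + u))) f = 0 := by
  set s : Fin 2 → MvPolynomial (Fin 2) ℂ :=
    Function.update 1 i (MvPolynomial.C c + MvPolynomial.X i) with hs
  set a : Fin 2 → MvPowerSeries (Fin 2) ℂ := fun k => X j ^ w k * (s k : MvPowerSeries (Fin 2) ℂ)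
    with ha
  have ha0 (k) : constantCoeff (a k) = 0 := by simp [ha, (hw k).ne']
  have hsub : HasSubst a := hasSubst_of_constantCoeff_zero ha0
  have hac (k) : IsConvergent (a k) :=
    isConvergent_mul (pow_mem (S := ConvergentSeries) (isConvergent_X j) _) (ofPoly (s k)).2
  obtain ⟨G, hfG, hG⟩ := exists_subst_pow_mul_eq hw hsub hfd
  have hGc : IsConvergent G := isConvergent_of_X_pow_mul (hfG ▸ isConvergent_subst hac ha0 hf)
  have hG0 : constantCoeff G = 0 := by
    rw [← coeff_zero_eq_constantCoeff_apply, coeff_eq_of_X_dvd_sub hG rfl, MvPolynomial.coeff_coe,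
      ← MvPolynomial.constantCoeff_eq, hs, constantCoeff_aeval_update_one, hc]
  have hG1 : coeff (Finsupp.single i 1) G ≠ 0 := by
    rwa [coeff_eq_of_X_dvd_sub hG (Finsupp.single_eq_of_ne hij.symm), MvPolynomial.coeff_coe, hs,
      coeff_single_aeval_update_one]
  obtain ⟨u, huc, hu0, hui, hGu⟩ := exists_subst_update_eq_zero hGc hG0 hG1
  refine ⟨u, huc, hu0, hui, ?_⟩
  have hsu := hasSubst_update_X (i := i) hu0
  have hzero : subst (Function.update X i u) (subst a f) = 0 := by
    rw [hfG, subst_mul hsu, hGu, mul_zero]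
  rw [subst_comp_subst_apply hsub hsu] at hzero
  convert hzero using 2
  funext k
  rcases eq_or_ne k i with rfl | hk
  · simp [ha, hs, subst_mul hsu, subst_pow hsu, subst_X hsu, subst_add hsu, hij.symm]
  · obtain rfl : k = j := by lia
    simp [ha, hs, hwj, subst_X hsu, hk]

theorem eval_pderiv_ne_zero_of_eval_eq_zero {i j : Fin 2} (hij : i ≠ j) {w : Fin 2 → ℕ}
    (hw : ∀ k, 0 < w k) {p : MvPolynomial (Fin 2) ℂ} {n : ℕ}
    (hp : MvPolynomial.IsWeightedHomogeneous w p n) (hM : HasFiniteMilnorNumber (ofPoly p)) {c : ℂ}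
    (hc : MvPolynomial.eval (Function.update 1 i c) p = 0) :
    MvPolynomial.eval (Function.update 1 i c) (MvPolynomial.pderiv i p) ≠ 0 := by
  intro hi
  have hEuler := congrArg (MvPolynomial.eval (Function.update 1 i c)) hp.sum_weight_X_mul_pderiv
  have hj : MvPolynomial.eval (Function.update 1 i c) (MvPolynomial.pderiv j p) = 0 := by
    rw [Fintype.sum_eq_add i j hij fun k hk => by lia] at hEuler
    simpa [hi, hc, hij.symm, (hw j).ne'] using hEuler
  have hP := eq_zero_of_forall_eval_pderiv_eq_zero hw hp hM (P := Function.update 1 i c) fun k => by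
    rcases eq_or_ne k i with rfl | hk
    · exact hi
    · obtain rfl : k = j := by lia
      exact hj
  simpa [hij.symm] using congrFun hP j

theorem isSaturation_iff {i j : Fin 2} (hij : i ≠ j) {p q : MvPolynomial (Fin 2) ℂ} :
    IsSaturation p q ↔ (∃ a b : ℕ, p = MvPolynomial.X i ^ a * MvPolynomial.X j ^ b * q) ∧
      ¬ MvPolynomial.X i ∣ q ∧ ¬ MvPolynomial.X j ∣ q := by
  obtain ⟨rfl, rfl⟩ | ⟨rfl, rfl⟩ : (i = 0 ∧ j = 1) ∨ (i = 1 ∧ j = 0) := by lia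
  · rfl
  · exact ⟨fun ⟨⟨a, b, h⟩, h0, h1⟩ => ⟨⟨b, a, by rw [h]; ring⟩, h1, h0⟩,
      fun ⟨⟨a, b, h⟩, h1, h0⟩ => ⟨⟨b, a, by rw [h]; ring⟩, h0, h1⟩⟩

theorem IsSaturation.exists_eq_X_pow_mul {i j : Fin 2} (hij : i ≠ j) {p q : MvPolynomial (Fin 2) ℂ}
    (h : IsSaturation p q) (hi : ¬ MvPolynomial.X i ∣ p) :
    ∃ l, p = MvPolynomial.X j ^ l * q := by
  obtain ⟨⟨a, l, hp⟩, -⟩ := (isSaturation_iff hij).mp h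
  obtain rfl : a = 0 := by_contra fun ha => hi <| by
    rw [hp, mul_assoc]
    exact (dvd_pow_self _ ha).mul_right _
  exact ⟨l, by rw [hp, pow_zero, one_mul]⟩

theorem IsSaturation.exists_isWeightedHomogeneous {p q : MvPolynomial (Fin 2) ℂ}
    (h : IsSaturation p q) {w : Fin 2 → ℕ} {d : ℕ} (hp0 : p ≠ 0)
    (hp : MvPolynomial.IsWeightedHomogeneous w p d) :
    ∃ n, MvPolynomial.IsWeightedHomogeneous w q n := by
  obtain ⟨⟨a, b, hpq⟩, -⟩ := h
  exact exists_isWeightedHomogeneous_of_dvd hp hp0 (Dvd.intro_left _ hpq.symm)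

theorem HasSmoothFacetAt.exists_simple_zero {i j : Fin 2} (hij : i ≠ j) {f : ConvergentSeries}
    (hnd : HasNondegenerateFacets f) (hs : HasSmoothFacetAt (f : MvPowerSeries (Fin 2) ℂ) i) :
    ∃ w d c, IsFacetWeight (f : MvPowerSeries (Fin 2) ℂ) w d ∧ w j = 1 ∧
      ¬ MvPolynomial.X i ∣ weightedJet w d (f : MvPowerSeries (Fin 2) ℂ) ∧
      MvPolynomial.eval (Function.update 1 i c)
        (weightedJet w d (f : MvPowerSeries (Fin 2) ℂ)) = 0 ∧
      MvPolynomial.eval (Function.update 1 i c)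
        (MvPolynomial.pderiv i (weightedJet w d (f : MvPowerSeries (Fin 2) ℂ))) ≠ 0 := by
  obtain ⟨w, d, hwd, hwj, hX⟩ := hs
  obtain ⟨h, hsat, hM⟩ := hasNondegenerateFacets_iff.mp hnd w d hwd
  obtain ⟨n, hn⟩ := hsat.exists_isWeightedHomogeneous hwd.weightedJet_ne_zero
    (isWeightedHomogeneous_weightedJet hwd.pos d _)
  obtain ⟨l, hl⟩ := hsat.exists_eq_X_pow_mul hij hX
  obtain ⟨c, hc⟩ := exists_eval_update_one_eq_zero hwd.pos hn
    (not_isUnit_of_hasFiniteMilnorNumber hM) hij ((isSaturation_iff hij).mp hsat).2.2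
  refine ⟨w, d, c, hwd, hwj j hij.symm, hX, by rw [hl, map_mul, hc, mul_zero], ?_⟩
  rw [hl, Derivation.leibniz, Derivation.leibniz_pow, MvPolynomial.pderiv_X_of_ne hij.symm]
  simpa [hij.symm] using eval_pderiv_ne_zero_of_eval_eq_zero hij hwd.pos hn hM hc

theorem IsFacetWeight.subst_shear {i : Fin 2} {f φ : MvPowerSeries (Fin 2) ℂ} {w : Fin 2 → ℕ}
    {d : ℕ} (h : IsFacetWeight f w d) (hφ0 : constantCoeff φ = 0)
    (hφ : φ ∈ weightIdeal w (w i + 1)) : IsFacetWeight (subst (shear i φ) f) w d := by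
  have hcoeff {n : Fin 2 →₀ ℕ} (hn : Finsupp.weight w n = d) :
      coeff n (subst (shear i φ) f) = coeff n f := by
    have hjet := congrArg (MvPolynomial.coeff n)
      (weightedJet_subst_shear_of_mem h.pos hφ0 hφ h.mem_weightIdeal)
    rwa [coeff_weightedJet h.pos, coeff_weightedJet h.pos, if_pos hn, if_pos hn] at hjet
  obtain ⟨m, n, hmn, hm, hn, hmd, hnd⟩ := h.exists_ne
  exact ⟨h.pos, h.coprime, subst_mem_weightIdeal (hasSubst_shear hφ0)
    (shear_mem_weightIdeal (weightIdeal_anti w (Nat.le_succ _) hφ)) h.mem_weightIdeal,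
    m, n, hmn, by rwa [hcoeff hmd], by rwa [hcoeff hnd], hmd, hnd⟩

theorem isFacetWeight_subst_shear_iff {i : Fin 2} {f φ : MvPowerSeries (Fin 2) ℂ} {w : Fin 2 → ℕ}
    {d : ℕ} (hφ0 : constantCoeff φ = 0) (hφi : φ ∈ varFree ℂ i) (hφ : φ ∈ weightIdeal w (w i + 1)) :
    IsFacetWeight (subst (shear i φ) f) w d ↔ IsFacetWeight f w d := by
  refine ⟨fun h => ?_, fun h => h.subst_shear hφ0 hφ⟩
  have hneg := h.subst_shear (i := i) (by rw [map_neg, hφ0, neg_zero]) (neg_mem hφ)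
  rwa [subst_shear_subst_shear hφ0 hφi (add_neg_cancel φ)] at hneg

theorem IsFacetWeight.coprime_of_ne {i j : Fin 2} (hij : i ≠ j) {f : MvPowerSeries (Fin 2) ℂ}
    {w : Fin 2 → ℕ} {d : ℕ} (h : IsFacetWeight f w d) : (w i).Coprime (w j) := by
  obtain ⟨rfl, rfl⟩ | ⟨rfl, rfl⟩ : (i = 0 ∧ j = 1) ∨ (i = 1 ∧ j = 0) := by lia
  · exact h.coprime
  · exact h.coprime.symm

theorem IsFacetWeight.not_isUnit_of_isSaturation {f : MvPowerSeries (Fin 2) ℂ} {w : Fin 2 → ℕ}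
    {d : ℕ} (h : IsFacetWeight f w d) {s : MvPolynomial (Fin 2) ℂ}
    (hs : IsSaturation (weightedJet w d f) s) : ¬ IsUnit s := by
  intro hu
  obtain ⟨c, -, rfl⟩ := MvPolynomial.isUnit_iff_eq_C_of_isReduced.mp hu
  obtain ⟨⟨a, b, hab⟩, -⟩ := hs
  have hjet : weightedJet w d f =
      MvPolynomial.monomial (Finsupp.single 0 a + Finsupp.single 1 b) c := by
    rw [hab, MvPolynomial.X_pow_eq_monomial, MvPolynomial.X_pow_eq_monomial,
      MvPolynomial.monomial_mul, mul_comm, MvPolynomial.C_mul_monomial, mul_one, mul_one]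
  have hunique {n : Fin 2 →₀ ℕ} (hn : coeff n f ≠ 0) (hnd : Finsupp.weight w n = d) :
      Finsupp.single 0 a + Finsupp.single 1 b = n := by
    classical
    have hcoeff := coeff_weightedJet h.pos d f n
    rw [if_pos hnd, hjet, MvPolynomial.coeff_monomial] at hcoeff
    exact by_contra fun hne => hn (by rw [← hcoeff, if_neg hne])
  obtain ⟨m, n, hmn, hm, hn, hmd, hnd⟩ := h.exists_ne
  exact hmn ((hunique hm hmd).symm.trans (hunique hn hnd))

theorem not_isFacetWeight_of_lt {i j : Fin 2} (hij : i ≠ j) {f : MvPowerSeries (Fin 2) ℂ}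
    (hf : X i ∣ f) {w : Fin 2 → ℕ} (hwj : w j = 1) {m : Fin 2 →₀ ℕ} (hm : coeff m f ≠ 0)
    (hmi : m i = 1) (hfm : f ∈ weightIdeal w (Finsupp.weight w m)) {w' : Fin 2 → ℕ}
    (hlt : w i * w' j < w' i) (d : ℕ) : ¬ IsFacetWeight f w' d := by
  intro h
  have hunique {n : Fin 2 →₀ ℕ} (hn : coeff n f ≠ 0) (hnd : Finsupp.weight w' n = d) : n = m := by
    obtain ⟨t, ht⟩ := Nat.exists_eq_succ_of_ne_zero fun hni => hn (X_dvd_iff.mp hf n hni)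
    have hw := _root_.mem_weightIdeal.mp hfm n hn
    have hw' := _root_.mem_weightIdeal.mp h.mem_weightIdeal m hm
    rw [weight_fin_two w _ hij, weight_fin_two w _ hij, hwj, hmi, ht] at hw
    rw [← hnd, weight_fin_two w' _ hij, weight_fin_two w' _ hij, hmi, ht] at hw'
    have hle : m j ≤ w i * t + n j := by
      rw [Nat.succ_eq_add_one, mul_add] at hw
      lia
    have hle' := Nat.mul_le_mul_left (w' j) hle
    have hlt' : (w i * w' j + 1) * t ≤ w' i * t := Nat.mul_le_mul_right t hlt
    obtain rfl : t = 0 := by nlinarith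
    refine finsupp_ext_fin_two hij (ht.trans hmi.symm) (le_antisymm ?_ (by simpa using hle))
    exact Nat.le_of_mul_le_mul_left (by lia) (h.pos j)
  obtain ⟨n, n', hnn, hn, hn', hnd, hnd'⟩ := h.exists_ne
  exact hnn ((hunique hn hnd).trans (hunique hn' hnd').symm)

end ConvergentSeries

namespace ConvergentSeries

theorem exists_isSaturation_aeval_polyShear {i j : Fin 2} (hij : i ≠ j)
    {p q h : MvPolynomial (Fin 2) ℂ} (hp0 : constantCoeff (p : MvPowerSeries (Fin 2) ℂ) = 0)
    (hp : (p : MvPowerSeries (Fin 2) ℂ) ∈ varFree ℂ i) (hsat : IsSaturation q h)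
    (hq : ¬ MvPolynomial.X i ∣ q)
    (hX : MvPolynomial.X i ∣ MvPolynomial.aeval (polyShear i p) q)
    (hX2 : ¬ MvPolynomial.X i ^ 2 ∣ MvPolynomial.aeval (polyShear i p) q) :
    ∃ s, IsSaturation (MvPolynomial.aeval (polyShear i p) q) s ∧
      MvPolynomial.aeval (polyShear i p) h = MvPolynomial.X i * s := by
  obtain ⟨l, hl⟩ := hsat.exists_eq_X_pow_mul hij hq
  have hXj (r : MvPolynomial (Fin 2) ℂ) :
      MvPolynomial.aeval (polyShear i r) (MvPolynomial.X j : MvPolynomial (Fin 2) ℂ) =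
        MvPolynomial.X j := by
    rw [MvPolynomial.aeval_X, polyShear_of_ne hij.symm]
  have hql : MvPolynomial.aeval (polyShear i p) q =
      MvPolynomial.X j ^ l * MvPolynomial.aeval (polyShear i p) h := by
    rw [hl, map_mul, map_pow, hXj]
  obtain ⟨s, hs⟩ : MvPolynomial.X i ∣ MvPolynomial.aeval (polyShear i p) h :=
    not_imp_not.mp (not_X_dvd_X_pow_mul hij · l) (hql ▸ hX)
  rw [hs] at hql
  refine ⟨s, (isSaturation_iff hij).mpr ⟨⟨1, l, by rw [hql]; ring⟩, ?_, fun hjs => ?_⟩, hs⟩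
  · rintro ⟨r, rfl⟩
    exact hX2 ⟨MvPolynomial.X j ^ l * r, by rw [hql]; ring⟩
  · have hdvd := map_dvd (MvPolynomial.aeval (polyShear i (-p))) (hjs.mul_left (MvPolynomial.X i))
    rw [← hs, hXj, aeval_polyShear_aeval_polyShear hp0 hp (add_neg_cancel p)] at hdvd
    exact ((isSaturation_iff hij).mp hsat).2.2 hdvd

/-- `X i = φ (X j)` is a smooth branch of `f`, and its leading term `c * X j ^ w i` is a simple
root of the jet of `f` along the facet of weight `w` and value `d`. -/
structure IsSimpleBranch (f : MvPowerSeries (Fin 2) ℂ) (i j : Fin 2) (w : Fin 2 → ℕ) (d : ℕ)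
    (c : ℂ) (φ : MvPowerSeries (Fin 2) ℂ) : Prop where
  isFacetWeight : IsFacetWeight f w d
  weight_eq_one : w j = 1
  not_X_dvd : ¬ MvPolynomial.X i ∣ weightedJet w d f
  eval_pderiv_ne_zero : MvPolynomial.eval (Function.update 1 i c)
    (MvPolynomial.pderiv i (weightedJet w d f)) ≠ 0
  mem_varFree : φ ∈ varFree ℂ i
  X_pow_dvd_sub : X j ^ (w i + 1) ∣ φ - C c * X j ^ w i
  subst_eq_zero : subst (Function.update X i φ) f = 0

theorem HasSmoothFacetAt.exists_isSimpleBranch {i j : Fin 2} (hij : i ≠ j) {f : ConvergentSeries}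
    (hnd : HasNondegenerateFacets f) (hs : HasSmoothFacetAt (f : MvPowerSeries (Fin 2) ℂ) i) :
    ∃ (w : Fin 2 → ℕ) (d : ℕ) (c : ℂ) (φ : ConvergentSeries),
      IsSimpleBranch (f : MvPowerSeries (Fin 2) ℂ) i j w d c φ := by
  obtain ⟨w, d, c, hwd, hwj, hX, hc, hc'⟩ := hs.exists_simple_zero hij hnd
  obtain ⟨u, huc, hu0, hui, hfu⟩ :=
    exists_smooth_branch hij f.2 hwd.pos hwj hwd.mem_weightIdeal hc hc'
  have hcu : C c + u ∈ varFree ℂ i := add_mem ((varFree ℂ i).algebraMap_mem c) hui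
  have hdvd : X j ^ (w i + 1) ∣ X j ^ w i * (C c + u) - C c * X j ^ w i := by
    rw [mul_add, mul_comm _ (C c), add_sub_cancel_left, pow_succ]
    exact mul_dvd_mul_left _ (X_dvd_of_mem_varFree hij hui hu0)
  refine ⟨w, d, c, ⟨X j ^ w i * (C c + u), isConvergent_mul
    (pow_mem (S := ConvergentSeries) (isConvergent_X j) _)
    (isConvergent_add (isConvergent_C c) huc)⟩,
    hwd, hwj, hX, hc', mul_mem (pow_mem (X_mem_varFree hij.symm) _) hcu, hdvd, hfu⟩

namespace IsSimpleBranch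

variable {f φ : MvPowerSeries (Fin 2) ℂ} {i j : Fin 2} {w : Fin 2 → ℕ} {d : ℕ} {c : ℂ}

theorem X_pow_dvd (h : IsSimpleBranch f i j w d c φ) : X j ^ w i ∣ φ :=
  (dvd_sub_left (Dvd.intro_left _ rfl)).mp ((pow_dvd_pow _ (Nat.le_succ _)).trans h.X_pow_dvd_sub)

theorem constantCoeff_eq_zero (h : IsSimpleBranch f i j w d c φ) : constantCoeff φ = 0 := by
  obtain ⟨r, rfl⟩ := h.X_pow_dvd
  rw [map_mul, map_pow, constantCoeff_X, zero_pow (h.isFacetWeight.pos i).ne', zero_mul]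

theorem X_dvd_subst_shear (h : IsSimpleBranch f i j w d c φ) : X i ∣ subst (shear i φ) f :=
  _root_.X_dvd_subst_shear h.constantCoeff_eq_zero h.mem_varFree h.subst_eq_zero

theorem subst_shear_mem_weightIdeal (h : IsSimpleBranch f i j w d c φ) :
    subst (shear i φ) f ∈ weightIdeal w d := by
  have hφ : φ ∈ weightIdeal w (w i) := by
    simpa [h.weight_eq_one] using mem_weightIdeal_of_X_pow_dvd h.X_pow_dvd w
  exact subst_mem_weightIdeal (hasSubst_shear h.constantCoeff_eq_zero)
    (shear_mem_weightIdeal hφ) h.isFacetWeight.mem_weightIdeal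

theorem weightedJet_subst_shear (h : IsSimpleBranch f i j w d c φ) :
    weightedJet w d (subst (shear i φ) f) = MvPolynomial.aeval
      (polyShear i (MvPolynomial.C c * MvPolynomial.X j ^ w i)) (weightedJet w d f) := by
  refine _root_.weightedJet_subst_shear h.isFacetWeight.pos h.constantCoeff_eq_zero ?_ ?_
    h.isFacetWeight.mem_weightIdeal
  · have hX := ((MvPolynomial.isWeightedHomogeneous_X ℂ w j).pow (w i)).C_mul c
    rwa [h.weight_eq_one, smul_eq_mul, mul_one] at hX
  · simpa [h.weight_eq_one] using mem_weightIdeal_of_X_pow_dvd h.X_pow_dvd_sub w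

theorem not_X_sq_dvd (hij : i ≠ j) (h : IsSimpleBranch f i j w d c φ) :
    ¬ MvPolynomial.X i ^ 2 ∣ weightedJet w d (subst (shear i φ) f) := by
  rw [h.weightedJet_subst_shear]
  refine not_X_sq_dvd_aeval_polyShear (Q := Function.update 1 i 0) ?_ (Function.update_self ..) ?_
  · rw [MvPolynomial.pderiv_C_mul, Derivation.leibniz_pow,
      MvPolynomial.pderiv_X_of_ne hij.symm, smul_zero, smul_zero, mul_zero]
  · rw [eval_polyShear_update_zero (c := c) (by simp [hij.symm])]
    exact h.eval_pderiv_ne_zero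

theorem exists_coeff_ne_zero (hij : i ≠ j) (h : IsSimpleBranch f i j w d c φ) :
    ∃ m, coeff m (subst (shear i φ) f) ≠ 0 ∧ m i = 1 ∧ Finsupp.weight w m = d := by
  have hX2 := h.not_X_sq_dvd hij
  rw [X_pow_dvd_iff_forall_le] at hX2
  push Not at hX2
  obtain ⟨m, hm, hmi⟩ := hX2
  rw [coeff_weightedJet h.isFacetWeight.pos, ne_eq, ite_eq_right_iff, Classical.not_imp] at hm
  have hmi0 : m i ≠ 0 := fun h0 => hm.2 (X_dvd_iff.mp h.X_dvd_subst_shear m h0)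
  exact ⟨m, hm.2, by lia, hm.1⟩

theorem eq_of_weight_eq (hij : i ≠ j) (h : IsSimpleBranch f i j w d c φ) {w' : Fin 2 → ℕ} {d' : ℕ}
    (hwd' : IsFacetWeight (subst (shear i φ) f) w' d') (hw' : w' i = w i * w' j) :
    w' = w ∧ d' = d := by
  have hw'j : w' j = 1 :=
    Nat.eq_one_of_dvd_coprimes (hwd'.coprime_of_ne hij) (Dvd.intro_left _ hw'.symm) dvd_rfl
  obtain rfl : w' = w := by
    funext k
    rcases eq_or_ne k i with rfl | hk
    · rw [hw', hw'j, mul_one]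
    · obtain rfl : k = j := by lia
      rw [hw'j, h.weight_eq_one]
  obtain ⟨m, hm, -, hmd⟩ := h.exists_coeff_ne_zero hij
  obtain ⟨m', -, -, hm', -, hmd', -⟩ := hwd'.exists_ne
  exact ⟨rfl, le_antisymm (hmd ▸ _root_.mem_weightIdeal.mp hwd'.mem_weightIdeal m hm)
    (hmd' ▸ _root_.mem_weightIdeal.mp h.subst_shear_mem_weightIdeal m' hm')⟩

theorem exists_isSaturation (hij : i ≠ j) (h : IsSimpleBranch f i j w d c φ)
    (hwd : IsFacetWeight (subst (shear i φ) f) w d) {q : MvPolynomial (Fin 2) ℂ}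
    (hsat : IsSaturation (weightedJet w d f) q) (hM : HasFiniteMilnorNumber (ofPoly q)) :
    ∃ s, IsSaturation (weightedJet w d (subst (shear i φ) f)) s ∧
      HasFiniteMilnorNumber (ofPoly s) := by
  set p : MvPolynomial (Fin 2) ℂ := MvPolynomial.C c * MvPolynomial.X j ^ w i with hp
  have hp0 : constantCoeff (p : MvPowerSeries (Fin 2) ℂ) = 0 := by
    simp [hp, (h.isFacetWeight.pos i).ne']
  have hpi : (p : MvPowerSeries (Fin 2) ℂ) ∈ varFree ℂ i := by
    rw [hp, MvPolynomial.coe_mul, MvPolynomial.coe_C, MvPolynomial.coe_pow, MvPolynomial.coe_X]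
    exact mul_mem ((varFree ℂ i).algebraMap_mem c) (pow_mem (X_mem_varFree hij.symm) _)
  have hX := X_dvd_weightedJet (d := d) hwd.pos h.X_dvd_subst_shear
  have hX2 := h.not_X_sq_dvd hij
  rw [h.weightedJet_subst_shear] at hX hX2
  obtain ⟨s, hs, hqs⟩ := exists_isSaturation_aeval_polyShear hij hp0 hpi hsat h.not_X_dvd hX hX2
  rw [← h.weightedJet_subst_shear] at hs
  obtain ⟨n, hn⟩ := hs.exists_isWeightedHomogeneous hwd.weightedJet_ne_zero
    (isWeightedHomogeneous_weightedJet hwd.pos d _)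
  have hs0 : s ≠ 0 := fun hs0 => hs.2.1 (hs0 ▸ dvd_zero _)
  have hn0 : n ≠ 0 := by
    rintro rfl
    exact hwd.not_isUnit_of_isSaturation hs (isUnit_of_isWeightedHomogeneous_zero hwd.pos hn hs0)
  exact ⟨s, hs, hasFiniteMilnorNumber_of_aeval_polyShear hp0 hpi hn hn0 hqs hM⟩

end IsSimpleBranch

/-- The shear does not affect facets flatter than that of the branch, and steeper ones disappear. -/
theorem exists_straightening {i j : Fin 2} (hij : i ≠ j) {f : ConvergentSeries}
    (hnd : HasNondegenerateFacets f) (hs : HasSmoothFacetAt (f : MvPowerSeries (Fin 2) ℂ) i) :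
    ∃ g : ConvergentSeries, RightEquivalent f g ∧ HasNondegenerateFacets g ∧
      X i ∣ (g : MvPowerSeries (Fin 2) ℂ) ∧
      (X j ∣ (f : MvPowerSeries (Fin 2) ℂ) → X j ∣ (g : MvPowerSeries (Fin 2) ℂ)) := by
  obtain ⟨w, d, c, φ, hφ⟩ := hs.exists_isSimpleBranch hij hnd
  have hφ0 := hφ.constantCoeff_eq_zero
  have hg := coe_shearEquiv φ hφ0 hφ.mem_varFree f
  refine ⟨shearEquiv i φ hφ0 hφ.mem_varFree f, ⟨_, rfl⟩, ?_, ?_, ?_⟩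
  · rw [hasNondegenerateFacets_iff] at hnd ⊢
    rw [hg]
    intro w' d' hwd'
    have hmem : (φ : MvPowerSeries (Fin 2) ℂ) ∈ weightIdeal w' (w i * w' j) :=
      mem_weightIdeal_of_X_pow_dvd hφ.X_pow_dvd w'
    rcases lt_trichotomy (w' i) (w i * w' j) with hlt | heq | hlt
    · have hmem' := weightIdeal_anti w' hlt hmem
      have hfwd := (isFacetWeight_subst_shear_iff hφ0 hφ.mem_varFree hmem').mp hwd'
      rw [weightedJet_subst_shear_of_mem hfwd.pos hφ0 hmem' hfwd.mem_weightIdeal]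
      exact hnd w' d' hfwd
    · obtain ⟨rfl, rfl⟩ := hφ.eq_of_weight_eq hij hwd' heq
      obtain ⟨q, hsat, hM⟩ := hnd w' d' hφ.isFacetWeight
      exact hφ.exists_isSaturation hij hwd' hsat hM
    · obtain ⟨m, hm, hmi, hmd⟩ := hφ.exists_coeff_ne_zero hij
      refine absurd hwd' (not_isFacetWeight_of_lt hij hφ.X_dvd_subst_shear hφ.weight_eq_one hm hmi
        ?_ hlt d')
      exact hmd ▸ hφ.subst_shear_mem_weightIdeal
  · rw [hg]
    exact hφ.X_dvd_subst_shear
  · rw [hg]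
    exact X_dvd_subst_shear_of_ne hφ0 hij.symm

theorem not_hasSmoothFacetAt_of_X_dvd {i : Fin 2} {f : MvPowerSeries (Fin 2) ℂ} (h : X i ∣ f) :
    ¬ HasSmoothFacetAt f i := by
  rintro ⟨w, d, hwd, -, hX⟩
  exact hX (X_dvd_weightedJet hwd.pos h)

theorem exists_rightEquivalent_not_hasSmoothFacetAt {f : ConvergentSeries}
    (hnd : HasNondegenerateFacets f) : ∃ g : ConvergentSeries, RightEquivalent f g ∧
      HasNondegenerateFacets g ∧ ∀ i, ¬ HasSmoothFacetAt (g : MvPowerSeries (Fin 2) ℂ) i := by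
  by_cases! hs : ∃ i, HasSmoothFacetAt (f : MvPowerSeries (Fin 2) ℂ) i
  · obtain ⟨i, hi⟩ := hs
    obtain ⟨j, hij⟩ := exists_ne i
    obtain ⟨g, ⟨φ, hφ⟩, hg, hgi, -⟩ := exists_straightening hij.symm hnd hi
    have hcases {P : Fin 2 → Prop} (hPi : P i) (hPj : P j) (k : Fin 2) : P k := by
      obtain rfl | rfl : k = i ∨ k = j := by lia
      exacts [hPi, hPj]
    by_cases hj : HasSmoothFacetAt (g : MvPowerSeries (Fin 2) ℂ) j
    · obtain ⟨g', ⟨φ', hφ'⟩, hg', hgj', hgi'⟩ := exists_straightening hij hg hj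
      exact ⟨g', ⟨φ.trans φ', by rw [AlgEquiv.trans_apply, hφ, hφ']⟩, hg',
        hcases (not_hasSmoothFacetAt_of_X_dvd (hgi' hgi)) (not_hasSmoothFacetAt_of_X_dvd hgj')⟩
    · exact ⟨g, ⟨φ, hφ⟩, hg, hcases (not_hasSmoothFacetAt_of_X_dvd hgi) hj⟩
  · exact ⟨f, ⟨AlgEquiv.refl, rfl⟩, hnd, hs⟩

end ConvergentSeries

end SmoothBranches

theorem mainTheorem11_general (f : ConvergentSeries)
    (hnd : ConvergentSeries.HasNondegenerateFacets f) :
    ∃ g : ConvergentSeries, ConvergentSeries.RightEquivalent f g ∧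
      ConvergentSeries.HasNondegenerateFacets g ∧
      ∀ Δ : Set (Fin 2 → ℝ), ConvergentSeries.IsFacet g Δ →
        ConvergentSeries.IsNormalizedAt g Δ := by
  obtain ⟨g, hfg, hg, hs⟩ := ConvergentSeries.exists_rightEquivalent_not_hasSmoothFacetAt hnd
  exact ⟨g, hfg, hg, fun _ hΔ => ConvergentSeries.isNormalizedAt_of_not_hasSmoothFacetAt hg hs hΔ⟩

theorem mainTheorem11 (f : ConvergentSeries) (hf : f ∈ ConvergentSeries.maxIdeal ^ 2)
    (hnd : ConvergentSeries.HasNondegenerateNewtonBoundary f) :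
    ∃ g : ConvergentSeries, ConvergentSeries.RightEquivalent f g ∧
      ConvergentSeries.HasNondegenerateFacets g ∧
      ∀ Δ : Set (Fin 2 → ℝ), ConvergentSeries.IsFacet g Δ →
        ConvergentSeries.IsNormalizedAt g Δ :=
  mainTheorem11_general f hnd.2
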